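/- Conventions. Let $\mathbb K$ be a commutative ring and let $G$ be a finite digraph with vertex set $V$ (loops, if present, play no role below). An $n$-path of $G$ is a sequence $(x_0,\dots,x_n)$ of vertices such that every $(x_i,x_{i+1})$ is an arrow. Let $\Lambda_n(V)$ be the free $\mathbb K$-module on all tuples $e_{x_0,\dots,x_n}$ with $x_i\in V$, with the differential $\partial e_{x_0,\dots,x_n}=\sum_{i=0}^n(-1)^i e_{x_0,\dots,\widehat{x_i},\dots,x_n}$ (and $\partial=0$ on $\Lambda_0(V)$), and let $\mathcal R_\bullet(V)$ be the quotient complex of $\Lambda_\bullet(V)$ by the subcomplex spanned by the tuples with $x_i=x_{i+1}$ for some $i$. Let $\mathcal A_n(G)\subseteq\mathcal R_n(V)$ be the submodule generated by the $n$-paths of $G$, and put $\Omega_n(G;\mathbb K)=\mathcal A_n(G)\cap\partial^{-1}(\mathcal A_{n-1}(G))$, with $\Omega_0(G;\mathbb K)=\mathcal A_0(G)$. The path homology $\mathrm{PH}_n(G;\mathbb K)$ is the $n$-th homology of the chain complex $\Omega_\bullet(G;\mathbb K)$; it is $0$ for $n<0$. For a field $\mathbb F$, the path Euler characteristic $\chi^{\mathbb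 F}(G)$ is defined if $\mathrm{PH}_n(G;\mathbb F)=0$ for all but finitely many $n$, and then $\chi^{\mathbb F}(G)=\sum_n(-1)^n\dim_{\mathbb F}\mathrm{PH}_n(G;\mathbb F)$. A topological space $X$ (respectively a chain complex $C_\bullet$ of free abelian groups, graded by $\mathbb Z$) has homology of finite type if every singular homology group $H_n(X;\mathbb Z)$ (respectively every $H_n(C_\bullet)$) is finitely generated. **Proposition.** Let $G$ be a finite digraph and $p$ a prime such that $\chi^{\mathbb Q}(G)$ and $\chi^{\mathbb Z/p\mathbb Z}(G)$ are defined and $\chi^{\mathbb Q}(G)\neq\chi^{\mathbb Z/p\mathbb Z}(G)$. Then: 1. There is no topological space $X$ such that there are isomorphisms of graded abelian groups $\mathrm{PH}_*(G;\mathbb K)\cong H_*(X;\mathbb K)$ for both $\mathbb K=\mathbb Z$ and $\mathbb K=\mathbb Z/p\mathbb Z$. 2. There is no topological space $X$ with homology of finite type such that there are isomorphisms of graded vector spaces $\mathrm{PH}_*(G;\mathbb F)\cong H_*(X;\mathbb F)$ for both $\mathbb F=\mathbb Q$ and $\mathbb F=\mathbb Z/p\mathbb Z$. 3. There is no chain complex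 $C_\bullet$ of free abelian groups with homology of finite type such that there are isomorphisms of graded vector spaces $\mathrm{PH}_*(G;\mathbb F)\cong H_*(C_\bullet\otimes_{\mathbb Z}\mathbb F)$ for both $\mathbb F=\mathbb Q$ and $\mathbb F=\mathbb Z/p\mathbb Z$. 4. There exists $n$ for which there is no short exact sequence of abelian groups $$0\to \mathrm{PH}_n(G;\mathbb Z)\otimes\mathbb Z/p\mathbb Z\to \mathrm{PH}_n(G;\mathbb Z/p\mathbb Z)\to \mathrm{Tor}_1^{\mathbb Z}(\mathrm{PH}_{n-1}(G;\mathbb Z),\mathbb Z/p\mathbb Z)\to 0 .$$ Moreover, let $\mathcal G$ be the digraph with the $11$ vertices $x_0$, $x_4$ and $x_j^i$ ($i\in\mathbb Z/3\mathbb Z$, $j\in\{1,2,3\}$) and with the arrows $x_0\to x_1^i$, $x_3^i\to x_4$, $x_j^i\to x_{j+1}^i$ and $x_j^i\to x_{j+1}^{i+1}$ for $j=1,2$, $x_1^i\to x_3^i$ and $x_1^i\to x_3^{i+2}$, for all $i\in\mathbb Z/3\mathbb Z$. Then $\chi^{\mathbb Q}(\mathcal G)$ and $\chi^{\mathbb Z/2\mathbb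 Z}(\mathcal G)$ are defined and $\chi^{\mathbb Q}(\mathcal G)\neq\chi^{\mathbb Z/2\mathbb Z}(\mathcal G)$, so that (1)–(4) hold for $G=\mathcal G$ and $p=2$. -/

import Mathlib

open CategoryTheory

universe u v w

noncomputable section

namespace PathHomology

section Chains

variable (K : Type v) [CommRing K] (V : Type u)

/-- `Λ_n(V)`: the free module on all `(n+1)`-tuples of elements of `V`. -/
abbrev Tuples (n : ℕ) : Type max u v := (Fin (n + 1) → V) →₀ K

variable {V} in
/-- The basis element `e_{x_0,…,x_n}` of `Λ_n(V)`. -/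
def tuple {n : ℕ} (x : Fin (n + 1) → V) : Tuples K V n := Finsupp.single x 1

/-- The differential of `Λ_•(V)`, the alternating sum of the maps that omit one entry. -/
def tuplesBoundary (n : ℕ) : Tuples K V (n + 1) →ₗ[K] Tuples K V n :=
  ∑ i : Fin (n + 2),
    (-1 : K) ^ (i : ℕ) • Finsupp.lmapDomain K K (fun x : Fin (n + 2) → V ↦ fun j ↦ x (i.succAbove j))

/-- The submodule of `Λ_n(V)` spanned by the tuples with two equal consecutive entries. -/
def degenerate (n : ℕ) : Submodule K (Tuples K V n) :=
  Submodule.span K {e | ∃ x : Fin (n + 1) → V, (∃ i : Fin n, x i.castSucc = x i.succ) ∧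
    e = tuple K x}

theorem tuplesBoundary_tuple (n : ℕ) (x : Fin (n + 2) → V) :
    tuplesBoundary K V n (tuple K x) =
      ∑ i : Fin (n + 2), (-1 : K) ^ (i : ℕ) • tuple K (fun j ↦ x (i.succAbove j)) := by
  simp [tuplesBoundary, tuple, LinearMap.sum_apply, Finsupp.mapDomain_single]

theorem degenerate_le_comap (n : ℕ) :
    degenerate K V (n + 1) ≤ (degenerate K V n).comap (tuplesBoundary K V n) := by
  refine Submodule.span_le.2 ?_
  rintro _ ⟨x, ⟨i, hi⟩, rfl⟩
  rw [SetLike.mem_coe, Submodule.mem_comap, tuplesBoundary_tuple,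
    ← Finset.add_sum_erase _ _ (Finset.mem_univ i.castSucc),
    ← Finset.add_sum_erase _ _ (Finset.mem_erase.2
      ⟨(Fin.castSucc_lt_succ (i := i)).ne', Finset.mem_univ i.succ⟩), ← add_assoc]
  have hface : (fun j ↦ x (i.castSucc.succAbove j)) = fun j ↦ x (i.succ.succAbove j) := by
    funext j
    rcases lt_trichotomy j i with h | h | h
    · rw [Fin.succAbove_of_castSucc_lt _ _ (by simpa using h),
        Fin.succAbove_of_castSucc_lt _ _ (by simp only [Fin.lt_def, Fin.val_castSucc, Fin.val_succ] at *; omega)]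
    · subst h
      simpa using hi.symm
    · rw [Fin.succAbove_of_le_castSucc _ _ (by simpa using h.le),
        Fin.succAbove_of_le_castSucc _ _ (by simp only [Fin.le_def, Fin.lt_def, Fin.val_castSucc, Fin.val_succ] at *; omega)]
  refine Submodule.add_mem _ ?_ (Submodule.sum_mem _ fun j hj ↦ Submodule.smul_mem _ _
    (Submodule.subset_span ⟨_, ?_, rfl⟩))
  · rw [hface, ← add_smul]
    simp [pow_succ]
  · simp only [Finset.mem_erase, Finset.mem_univ, and_true, ne_eq, Fin.ext_iff, Fin.val_succ,
      Fin.val_castSucc] at hj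
    have hx : ∀ a b : Fin (n + 2), (a : ℕ) = i → (b : ℕ) = i + 1 → x a = x b := by
      intro a b ha hb
      have ha' : a = i.castSucc := Fin.ext ha
      have hb' : b = i.succ := Fin.ext (by simpa using hb)
      rw [ha', hb', hi]
    have hjl := j.isLt
    have hil := i.isLt
    rcases lt_or_gt_of_ne hj.2 with h | h
    · refine ⟨⟨i - 1, by omega⟩, hx _ _ ?_ ?_⟩ <;>
        simp only [Fin.succAbove, Fin.lt_def, Fin.castSucc_mk, Fin.succ_mk] <;> split_ifs <;> simp <;> omega
    · refine ⟨⟨i, by omega⟩, hx _ _ ?_ ?_⟩ <;>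
        simp only [Fin.succAbove, Fin.lt_def, Fin.castSucc_mk, Fin.succ_mk] <;> split_ifs <;> simp <;> omega

theorem tuplesBoundary_comp (n : ℕ) :
    tuplesBoundary K V n ∘ₗ tuplesBoundary K V (n + 1) = 0 := by
  refine Finsupp.lhom_ext' fun x ↦ LinearMap.ext_ring ?_
  change tuplesBoundary K V n (tuplesBoundary K V (n + 1) (tuple K x)) = 0
  simp only [tuplesBoundary_tuple, map_sum, map_smul, Finset.smul_sum, smul_smul]
  rw [← Finset.sum_product', Finset.univ_product_univ]
  refine Finset.sum_involution (fun a _ ↦ (a.1.succAbove a.2, a.2.predAbove a.1)) ?_ ?_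
    (fun _ _ ↦ Finset.mem_univ _) ?_
  · rintro ⟨i, j⟩ -
    simp only [Fin.succAbove_succAbove_succAbove_predAbove, ← pow_add,
      Fin.neg_one_pow_succAbove_add_predAbove, neg_smul, add_neg_cancel]
  · rintro ⟨i, j⟩ - - h
    exact Fin.succAbove_ne i j (Prod.ext_iff.1 h).1
  · rintro ⟨i, j⟩ -
    simp only [Fin.succAbove_succAbove_predAbove, Fin.predAbove_predAbove_succAbove]

/-- `R_n(V)`: the quotient of `Λ_n(V)` by the tuples with consecutive repetitions. -/
abbrev Regular (n : ℕ) : Type max u v := Tuples K V n ⧸ degenerate K V n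

/-- The differential of `R_•(V)`, induced by that of `Λ_•(V)`. -/
def regularBoundary (n : ℕ) : Regular K V (n + 1) →ₗ[K] Regular K V n :=
  (degenerate K V (n + 1)).mapQ (degenerate K V n) (tuplesBoundary K V n)
    (degenerate_le_comap K V n)

theorem regularBoundary_regularBoundary (n : ℕ) (x : Regular K V (n + 2)) :
    regularBoundary K V n (regularBoundary K V (n + 1) x) = 0 := by
  obtain ⟨y, rfl⟩ := Submodule.Quotient.mk_surjective _ x
  have h := LinearMap.congr_fun (tuplesBoundary_comp K V n) y
  simp only [LinearMap.comp_apply, LinearMap.zero_apply] at h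
  simp only [regularBoundary, Submodule.mapQ_apply, h, Submodule.Quotient.mk_zero]

end Chains

section Path

variable (K : Type v) [CommRing K] {V : Type u} (G : Digraph V)

/-- `A_n(G)`: the submodule of `R_n(V)` generated by the `n`-paths of `G`, i.e. by the
sequences `x_0, …, x_n` of vertices such that every `(x_i, x_{i+1})` is an arrow. -/
def allowed (n : ℕ) : Submodule K (Regular K V n) :=
  Submodule.span K {e | ∃ x : Fin (n + 1) → V, (∀ i : Fin n, G.Adj (x i.castSucc) (x i.succ)) ∧
    e = (degenerate K V n).mkQ (tuple K x)}

/-- `Ω_n(G) = A_n(G) ∩ ∂⁻¹(A_{n-1}(G))`, the module of path `n`-chains. -/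
def pathChains : (n : ℕ) → Submodule K (Regular K V n)
  | 0 => allowed K G 0
  | n + 1 => allowed K G (n + 1) ⊓ (allowed K G n).comap (regularBoundary K V n)

theorem regularBoundary_mem (n : ℕ) (x : Regular K V (n + 1)) (hx : x ∈ pathChains K G (n + 1)) :
    regularBoundary K V n x ∈ pathChains K G n := by
  cases n with
  | zero => exact hx.2
  | succ n =>
    refine ⟨hx.2, ?_⟩
    change regularBoundary K V n (regularBoundary K V (n + 1) x) ∈ allowed K G n
    rw [regularBoundary_regularBoundary]
    exact Submodule.zero_mem _

/-- The differential of the path chain complex `Ω_•(G)`. -/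
def pathBoundary (n : ℕ) : pathChains K G (n + 1) →ₗ[K] pathChains K G n :=
  (regularBoundary K V n).restrict (regularBoundary_mem K G n)

theorem pathBoundary_comp (n : ℕ) : pathBoundary K G n ∘ₗ pathBoundary K G (n + 1) = 0 :=
  LinearMap.ext fun x ↦ Subtype.ext (regularBoundary_regularBoundary K V n x.1)

/-- The path chain complex `Ω_•(G; K)`. -/
def pathComplex : ChainComplex (ModuleCat.{max u v} K) ℕ :=
  ChainComplex.of (fun n ↦ ModuleCat.of K (pathChains K G n))
    (fun n ↦ ModuleCat.ofHom (pathBoundary K G n)) (fun n ↦ by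
      rw [← ModuleCat.ofHom_comp, pathBoundary_comp, ModuleCat.ofHom_zero])

/-- The path homology `PH_n(G; K)`, graded by all integers; it is zero for `n < 0`. -/
def pathHomology : ℤ → ModuleCat.{max u v} K
  | .ofNat n => (pathComplex K G).homology n
  | .negSucc _ => ModuleCat.of K PUnit

end Path

section EulerCharacteristic

variable (F : Type v) [Field F] {V : Type u} (G : Digraph V)

/-- For a finite digraph `G`, the path Euler characteristic over `F` is defined if `PH_n(G; F)`
vanishes for all but finitely many `n`. (The vector spaces `PH_n(G; F)` are finite-dimensional,
because `G` is finite.) -/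
def PathEulerDefined : Prop := {n : ℤ | ¬ Subsingleton (pathHomology F G n)}.Finite

/-- The path Euler characteristic of a finite digraph, meaningful if `PathEulerDefined F G`. -/
def pathEuler : ℤ :=
  ∑ᶠ n : ℕ, (-1 : ℤ) ^ n * (Module.finrank F (pathHomology F G n) : ℤ)

end EulerCharacteristic

/-- The singular homology `H_n(X; K)` as a `K`-module. -/
abbrev singularHomology (K : Type) [CommRing K] (X : TopCat.{w}) (n : ℕ) : ModuleCat.{w} K :=
  ((AlgebraicTopology.singularHomologyFunctor (ModuleCat.{w} K) n).obj
    (ModuleCat.of K (ULift.{w} K))).obj X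

instance extendScalars_additive (K : Type) [CommRing K] :
    (ModuleCat.extendScalars.{0, 0, w} (algebraMap ℤ K)).Additive :=
  (ModuleCat.extendRestrictScalarsAdj.{w} (algebraMap ℤ K)).left_adjoint_additive

/-- The complex `C_• ⊗_ℤ K` of `K`-modules obtained from a complex `C_•` of abelian groups. -/
abbrev tensorComplex (C : ChainComplex (ModuleCat.{w} ℤ) ℤ) (K : Type) [CommRing K] :
    ChainComplex (ModuleCat.{w} K) ℤ :=
  ((ModuleCat.extendScalars.{0, 0, w} (algebraMap ℤ K)).mapHomologicalComplex _).obj C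

/-- `Tor(A, B) = Tor_1^ℤ(A, B)`. -/
abbrev tor (A B : ModuleCat.{0} ℤ) : ModuleCat.{0} ℤ := ((Tor (ModuleCat.{0} ℤ) 1).obj A).obj B

/-- The vertices of the digraph `𝒢`; here `x1 i` is `x_1^i`, and so on. -/
inductive ExampleVertex : Type
  | x0 : ExampleVertex
  | x1 (i : ZMod 3) : ExampleVertex
  | x2 (i : ZMod 3) : ExampleVertex
  | x3 (i : ZMod 3) : ExampleVertex
  | x4 : ExampleVertex

open ExampleVertex in
instance : Finite ExampleVertex := by
  refine Finite.of_surjective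
    (fun a : Fin 5 × ZMod 3 ↦ match a.1 with
      | 0 => x0
      | 1 => x1 a.2
      | 2 => x2 a.2
      | 3 => x3 a.2
      | 4 => x4) ?_
  rintro (_ | i | i | i | _)
  exacts [⟨(0, 0), rfl⟩, ⟨(1, i), rfl⟩, ⟨(2, i), rfl⟩, ⟨(3, i), rfl⟩, ⟨(4, 0), rfl⟩]

open ExampleVertex in
/-- The digraph `𝒢`. -/
def exampleDigraph : Digraph ExampleVertex where
  Adj
    | x0, x1 _ => True
    | x1 i, x2 j => j = i ∨ j = i + 1
    | x2 i, x3 j => j = i ∨ j = i + 1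
    | x3 _, x4 => True
    | x1 i, x3 j => j = i ∨ j = i + 2
    | _, _ => False

end PathHomology

end

noncomputable section
namespace PathHomology

section Counting

/-- The index of `pA` in an abelian group `A`, as a natural number. -/
abbrev mulIndex (p : ℕ) (A : Type*) [AddCommGroup A] : ℕ :=
  (nsmulAddMonoidHom p : A →+ A).range.index

/-- The cardinality of the `p`-torsion of an abelian group `A`. -/
abbrev torsionCard (p : ℕ) (A : Type*) [AddCommGroup A] : ℕ :=
  Nat.card (nsmulAddMonoidHom p : A →+ A).ker

variable {p : ℕ}

theorem mulIndex_congr {A B : Type*} [AddCommGroup A] [AddCommGroup B] (e : A ≃+ B) :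
    mulIndex p A = mulIndex p B := by
  have h : (nsmulAddMonoidHom p : A →+ A).range =
      ((nsmulAddMonoidHom p : B →+ B).range).comap e.toAddMonoidHom := by
    ext x
    constructor
    · rintro ⟨y, rfl⟩
      exact ⟨e y, by simp⟩
    · rintro ⟨y, hy⟩
      exact ⟨e.symm y, e.injective (by simpa using hy)⟩
  rw [mulIndex, h, AddSubgroup.index_comap_of_surjective _ e.surjective]

theorem torsionCard_congr {A B : Type*} [AddCommGroup A] [AddCommGroup B] (e : A ≃+ B) :
    torsionCard p A = torsionCard p B :=
  Nat.card_congr (e.toEquiv.subtypeEquiv fun a ↦ by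
    simp only [AddMonoidHom.mem_ker, nsmulAddMonoidHom_apply]
    exact ⟨fun h ↦ by simpa using congrArg e h, fun h ↦ e.injective (by simpa using h)⟩)

/-- The homology `ker g / im f` of two consecutive homomorphisms of abelian groups. -/
abbrev KerModRange {A B C : Type*} [AddCommGroup A] [AddCommGroup B] [AddCommGroup C]
    (f : A →+ B) (g : B →+ C) : Type _ :=
  g.ker ⧸ f.range.addSubgroupOf g.ker

variable {A B C D A' B' C' : Type*} [AddCommGroup A] [AddCommGroup B] [AddCommGroup C]
  [AddCommGroup D] [AddCommGroup A'] [AddCommGroup B'] [AddCommGroup C']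

theorem card_kerModRange (f : A →+ B) (g : B →+ C) :
    Nat.card (KerModRange f g) = f.range.relIndex g.ker := rfl

theorem mulIndex_kerModRange (f : A →+ B) (g : B →+ C) (hfg : ∀ a, g (f a) = 0)
    (hC : ∀ c : C, p • c = 0 → c = 0) :
    mulIndex p (KerModRange f g) =
      (f.range ⊔ (nsmulAddMonoidHom p : B →+ B).range).relIndex
        (g.ker ⊔ (nsmulAddMonoidHom p : B →+ B).range) := by
  set P := (nsmulAddMonoidHom p : B →+ B).range
  have hf : f.range ≤ g.ker := by
    rintro _ ⟨a, rfl⟩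
    exact hfg a
  have h1 : ((nsmulAddMonoidHom p : KerModRange f g →+ KerModRange f g).range).comap
      (QuotientAddGroup.mk' (f.range.addSubgroupOf g.ker)) =
      (f.range ⊔ P).addSubgroupOf g.ker := by
    ext ⟨x, hx⟩
    simp only [AddSubgroup.mem_comap, AddMonoidHom.mem_range, nsmulAddMonoidHom_apply,
      AddSubgroup.mem_addSubgroupOf]
    constructor
    · rintro ⟨y, hy⟩
      obtain ⟨y, rfl⟩ := QuotientAddGroup.mk'_surjective _ y
      rw [← map_nsmul, QuotientAddGroup.mk'_eq_mk'] at hy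
      obtain ⟨z, hz, hyz⟩ := hy
      have := congrArg Subtype.val hyz
      refine AddSubgroup.mem_sup.2 ⟨z, hz, p • y.1, ⟨y.1, rfl⟩, ?_⟩
      rw [add_comm]
      exact this
    · intro h
      obtain ⟨_, ⟨a, rfl⟩, _, ⟨b, rfl⟩, rfl⟩ := AddSubgroup.mem_sup.1 h
      have hb : b ∈ g.ker := by
        refine hC _ ?_
        have : g (f a + p • b) = 0 := hx
        rw [map_add, hfg, zero_add, map_nsmul] at this
        exact this
      refine ⟨QuotientAddGroup.mk' _ ⟨b, hb⟩, ?_⟩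
      rw [← map_nsmul, QuotientAddGroup.mk'_eq_mk']
      exact ⟨⟨f a, hfg a⟩, ⟨a, rfl⟩, Subtype.ext (add_comm _ _)⟩
  rw [mulIndex, ← AddSubgroup.index_comap_of_surjective _
    (QuotientAddGroup.mk'_surjective (f.range.addSubgroupOf g.ker)), h1]
  change (f.range ⊔ P).relIndex g.ker = _
  rw [← AddSubgroup.relIndex_sup_right (K := f.range ⊔ P) (H := g.ker), ← sup_assoc,
    sup_eq_left.2 hf]

theorem torsionCard_kerModRange (f : A →+ B) (g : B →+ C) :
    torsionCard p (KerModRange f g) =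
      f.range.relIndex (f.range.comap (nsmulAddMonoidHom p : B →+ B) ⊓ g.ker) := by
  set M := f.range.comap (nsmulAddMonoidHom p : B →+ B) ⊓ g.ker
  set q := QuotientAddGroup.mk' (f.range.addSubgroupOf g.ker)
  have hq : Function.Surjective q := QuotientAddGroup.mk'_surjective _
  have h1 : (nsmulAddMonoidHom p : KerModRange f g →+ KerModRange f g).ker.comap q =
      M.addSubgroupOf g.ker := by
    ext x
    simp only [AddSubgroup.mem_comap, AddMonoidHom.mem_ker, nsmulAddMonoidHom_apply,
      AddSubgroup.mem_addSubgroupOf]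
    rw [← map_nsmul]
    refine (QuotientAddGroup.eq_zero_iff _).trans ⟨fun h ↦ ⟨h, x.2⟩, fun h ↦ h.1⟩
  have h2 : (⊥ : AddSubgroup (KerModRange f g)).comap q = f.range.addSubgroupOf g.ker :=
    QuotientAddGroup.ker_mk' _
  rw [torsionCard, ← AddSubgroup.relIndex_bot_left,
    ← AddSubgroup.map_comap_eq_self_of_surjective hq (AddMonoidHom.ker _),
    ← AddSubgroup.relIndex_comap, h1, h2, AddSubgroup.relIndex_addSubgroupOf inf_le_right]

/-- The universal coefficient count: reduction of a torsion-free complex modulo `p`. -/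
theorem card_kerModRange_of_reduction (f : A →+ B) (g : B →+ C) (h : C →+ D)
    (f' : A' →+ B') (g' : B' →+ C') (a : A →+ A') (b : B →+ B') (c : C →+ C')
    (hfg : ∀ x, g (f x) = 0) (hgh : ∀ x, h (g x) = 0)
    (hf : ∀ x, b (f x) = f' (a x)) (hg : ∀ x, c (g x) = g' (b x))
    (ha : Function.Surjective a) (hb : Function.Surjective b)
    (hb' : ∀ x, b x = 0 ↔ ∃ y, p • y = x) (hc' : ∀ x, c x = 0 ↔ ∃ y, p • y = x)
    (hC : ∀ c : C, p • c = 0 → c = 0) (hD : ∀ d : D, p • d = 0 → d = 0) :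
    Nat.card (KerModRange f' g') =
      mulIndex p (KerModRange f g) * torsionCard p (KerModRange g h) := by
  set P := (nsmulAddMonoidHom p : B →+ B).range
  set L := g'.ker.comap b
  set M := g.range.comap (nsmulAddMonoidHom p : C →+ C) ⊓ h.ker
  have hinj : Function.Injective (nsmulAddMonoidHom p : C →+ C) :=
    (injective_iff_map_eq_zero _).2 hC
  have h1 : f'.range.comap b = f.range ⊔ P := by
    ext x
    constructor
    · rintro ⟨y, hy⟩
      obtain ⟨y, rfl⟩ := ha y
      obtain ⟨z, hz⟩ := (hb' (x - f y)).1 (by rw [map_sub, hf, hy, sub_self])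
      exact AddSubgroup.mem_sup.2 ⟨f y, ⟨y, rfl⟩, p • z, ⟨z, rfl⟩, by rw [hz]; abel⟩
    · intro hx
      obtain ⟨_, ⟨y, rfl⟩, _, ⟨z, rfl⟩, rfl⟩ := AddSubgroup.mem_sup.1 hx
      exact ⟨a y, by rw [map_add, hf, nsmulAddMonoidHom_apply, (hb' (p • z)).2 ⟨z, rfl⟩, add_zero]⟩
  have hFP : f.range ⊔ P ≤ g.ker ⊔ P := by
    refine sup_le_sup_right ?_ _
    rintro _ ⟨x, rfl⟩
    exact hfg x
  have hL : ∀ x, x ∈ L ↔ ∃ y, p • y = g x := fun x ↦ by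
    rw [← hc', hg]
    rfl
  have hgL : g.ker ≤ L := fun x hx ↦ (hL x).2 ⟨0, by rw [smul_zero]; exact hx.symm⟩
  have hPL : P ≤ L := by
    rintro _ ⟨x, rfl⟩
    exact (hL _).2 ⟨g x, (map_nsmul g p x).symm⟩
  have h2 : P.map g = g.range.map (nsmulAddMonoidHom p : C →+ C) := by
    ext x
    constructor
    · rintro ⟨_, ⟨y, rfl⟩, rfl⟩
      exact ⟨g y, ⟨y, rfl⟩, (map_nsmul g p y).symm⟩
    · rintro ⟨_, ⟨y, rfl⟩, rfl⟩
      exact ⟨p • y, ⟨y, rfl⟩, map_nsmul g p y⟩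
  have h3 : L.map g = M.map (nsmulAddMonoidHom p : C →+ C) := by
    ext x
    constructor
    · rintro ⟨y, hy, rfl⟩
      obtain ⟨z, hz⟩ := (hL y).1 hy
      exact ⟨z, ⟨⟨y, hz.symm⟩, hD _ (by rw [← map_nsmul, hz, hgh])⟩, hz⟩
    · rintro ⟨z, ⟨⟨y, hy⟩, -⟩, rfl⟩
      exact ⟨y, (hL y).2 ⟨z, hy.symm⟩, hy⟩
  have h4 : (g.ker ⊔ P).relIndex L = g.range.relIndex M := by
    rw [← AddSubgroup.relIndex_map_map_of_injective _ _ hinj, ← h2, ← h3,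
      AddSubgroup.relIndex_map_map, sup_eq_left.2 hgL, sup_comm]
  rw [mulIndex_kerModRange f g hfg hC, torsionCard_kerModRange, ← h4,
    AddSubgroup.relIndex_mul_relIndex _ _ _ hFP (sup_le hgL hPL), ← h1,
    AddSubgroup.relIndex_comap, AddSubgroup.map_comap_eq_self_of_surjective hb]
  rfl

/-- The homology of a complex at the end, where no torsion of the next group enters. -/
theorem card_kerModRange_zero_of_reduction (f : A →+ B) (g : B →+ C) (f' : A' →+ B')
    (g' : B' →+ C') (a : A →+ A') (b : B →+ B') (hf : ∀ x, b (f x) = f' (a x))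
    (ha : Function.Surjective a) (hb : Function.Surjective b)
    (hb' : ∀ x, b x = 0 ↔ ∃ y, p • y = x) (hg : g = 0) (hg' : g' = 0) :
    Nat.card (KerModRange f' g') = mulIndex p (KerModRange f g) := by
  subst hg hg'
  have h := card_kerModRange_of_reduction (p := p) f (0 : B →+ Unit) (0 : Unit →+ Unit) f'
    (0 : B' →+ Unit) a b 0 (fun _ ↦ rfl) (fun _ ↦ rfl) hf (fun _ ↦ rfl) ha hb hb'
    (fun _ ↦ ⟨fun _ ↦ ⟨0, rfl⟩, fun _ ↦ rfl⟩) (fun _ _ ↦ rfl) (fun _ _ ↦ rfl)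
  rw [torsionCard_kerModRange] at h
  have h1 : (0 : B →+ Unit).ker = (0 : B →+ C).ker := by simp
  have h2 : (0 : B' →+ Unit).ker = (0 : B' →+ C').ker := by simp
  have h3 : ((0 : B →+ Unit).range.relIndex
      ((0 : B →+ Unit).range.comap (nsmulAddMonoidHom p) ⊓ (0 : Unit →+ Unit).ker)) = 1 :=
    AddSubgroup.relIndex_eq_one.2 fun x _ ↦ ⟨0, rfl⟩
  rw [h3, mul_one, card_kerModRange, h2] at h
  have e : KerModRange f (0 : B →+ Unit) ≃+ KerModRange f (0 : B →+ C) :=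
    QuotientAddGroup.congr _ _ (AddEquiv.addSubgroupCongr h1) (by
      ext ⟨x, hx⟩
      simp only [AddSubgroup.mem_map, AddSubgroup.mem_addSubgroupOf]
      exact ⟨fun ⟨y, hy, hxy⟩ ↦ by
        obtain rfl : y.1 = x := congrArg Subtype.val hxy
        exact hy, fun h ↦ ⟨⟨x, rfl⟩, h, rfl⟩⟩)
  rw [card_kerModRange, h, mulIndex_congr e]

end Counting

section Complexes

variable {R : Type*} [Ring R]

/-- The homology of a complex of modules in terms of elements. -/
def homologyEquiv {ι : Type*} {c : ComplexShape ι} (K : HomologicalComplex (ModuleCat.{w} R) c)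
    (i j k : ι) (hi : c.prev j = i) (hk : c.next j = k) :
    K.homology j ≃ₗ[R] LinearMap.ker (K.d j k).hom ⧸
      (LinearMap.range (K.d i j).hom).submoduleOf (LinearMap.ker (K.d j k).hom) :=
  ((K.homologyIsoSc' i j k hi hk) ≪≫ (K.sc' i j k).moduleCatHomologyIso).toLinearEquiv ≪≫ₗ
    Submodule.quotEquivOfEq _ _ (by
      ext x
      constructor
      · rintro ⟨y, rfl⟩
        exact ⟨y, rfl⟩
      · rintro ⟨y, hy⟩
        exact ⟨y, Subtype.ext hy⟩)

/-- The homology of a complex of modules as an abelian group. -/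
def homologyAddEquiv {ι : Type*} {c : ComplexShape ι} (K : HomologicalComplex (ModuleCat.{w} R) c)
    (i j k : ι) (hi : c.prev j = i) (hk : c.next j = k) :
    K.homology j ≃+ KerModRange (K.d i j).hom.toAddMonoidHom (K.d j k).hom.toAddMonoidHom :=
  (homologyEquiv K i j k hi hk).toAddEquiv.trans (QuotientAddGroup.congr _ _ (AddEquiv.refl _)
    (by
      ext x
      simp only [AddSubgroup.mem_map]
      exact ⟨fun ⟨y, hy, hxy⟩ ↦ by rw [← hxy]; exact hy, fun h ↦ ⟨x, h, rfl⟩⟩))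

/-- A homomorphism from a complex of torsion-free abelian groups to a complex of modules over
another ring that is, in every degree, the reduction modulo `p`. -/
structure IsReduction (p : ℕ) {S : Type*} [Ring S] {ι : Type*} {c : ComplexShape ι}
    (K : HomologicalComplex (ModuleCat.{w} R) c) (L : HomologicalComplex (ModuleCat.{v} S) c)
    (φ : ∀ i, K.X i →+ L.X i) : Prop where
  comm : ∀ i j, c.Rel i j → ∀ x, φ j ((K.d i j).hom x) = (L.d i j).hom (φ i x)
  surjective : ∀ i, Function.Surjective (φ i)
  eq_zero_iff : ∀ i x, φ i x = 0 ↔ ∃ y, p • y = x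
  torsionFree : ∀ i, ∀ x : K.X i, p • x = 0 → x = 0

variable {p : ℕ} {S : Type*} [Ring S] {ι : Type*} {c : ComplexShape ι}
  {K : HomologicalComplex (ModuleCat.{w} R) c} {L : HomologicalComplex (ModuleCat.{v} S) c}
  {φ : ∀ i, K.X i →+ L.X i}

theorem IsReduction.comm' (h : IsReduction p K L φ) (i j : ι) (x : K.X i) :
    φ j ((K.d i j).hom x) = (L.d i j).hom (φ i x) := by
  by_cases hij : c.Rel i j
  · exact h.comm i j hij x
  · simp [K.shape i j hij, L.shape i j hij]

theorem hom_d_hom_d (K : HomologicalComplex (ModuleCat.{w} R) c) (i j k : ι)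
    (x : K.X i) : (K.d j k).hom ((K.d i j).hom x) = 0 := by
  rw [← LinearMap.comp_apply, ← ModuleCat.hom_comp, K.d_comp_d, ModuleCat.hom_zero,
    LinearMap.zero_apply]

/-- The universal coefficient count for complexes. -/
theorem IsReduction.card_homology (h : IsReduction p K L φ) {i j : ι} (hij : c.Rel i j) :
    Nat.card (L.homology i) = mulIndex p (K.homology i) * torsionCard p (K.homology j) := by
  rw [Nat.card_congr (homologyAddEquiv L _ i _ rfl rfl).toEquiv,
    mulIndex_congr (homologyAddEquiv K _ i _ rfl rfl),
    torsionCard_congr (homologyAddEquiv K i j _ (c.prev_eq' hij) rfl)]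
  obtain rfl := c.next_eq' hij
  exact card_kerModRange_of_reduction _ _ _ _ _ (φ _) (φ _) (φ _) (fun x ↦ hom_d_hom_d K _ _ _ x)
    (fun x ↦ hom_d_hom_d K _ _ _ x) (h.comm' _ _) (h.comm' _ _) (h.surjective _)
    (h.surjective _) (h.eq_zero_iff _) (h.eq_zero_iff _) (h.torsionFree _) (h.torsionFree _)

theorem IsReduction.card_homology_of_not_rel (h : IsReduction p K L φ) {i : ι}
    (hi : ¬ c.Rel i (c.next i)) : Nat.card (L.homology i) = mulIndex p (K.homology i) := by
  rw [Nat.card_congr (homologyAddEquiv L _ i _ rfl rfl).toEquiv,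
    mulIndex_congr (homologyAddEquiv K _ i _ rfl rfl)]
  exact card_kerModRange_zero_of_reduction _ _ _ _ (φ _) (φ _) (h.comm' _ _) (h.surjective _)
    (h.surjective _) (h.eq_zero_iff _) (by rw [K.shape _ _ hi]; rfl) (by rw [L.shape _ _ hi]; rfl)

theorem finrank_int_congr {M N : Type*} [AddCommGroup M] {inst : Module ℤ M} [AddCommGroup N]
    {inst' : Module ℤ N} (e : M ≃+ N) : Module.finrank ℤ M = Module.finrank ℤ N := by
  obtain rfl : inst = AddCommGroup.toIntModule M := Subsingleton.elim _ _
  obtain rfl : inst' = AddCommGroup.toIntModule N := Subsingleton.elim _ _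
  exact e.toIntLinearEquiv.finrank_eq

/-- A homomorphism that becomes an isomorphism after tensoring with `ℚ` preserves the rank. -/
theorem finrank_eq_of_rational {M N : Type*} [AddCommGroup M] {inst : Module ℤ M} [AddCommGroup N]
    [Module ℚ N] (φ : M →+ N) (h1 : ∀ y, ∃ k : ℤ, k ≠ 0 ∧ ∃ x, φ x = k • y)
    (h2 : ∀ x, φ x = 0 → ∃ k : ℤ, k ≠ 0 ∧ k • x = 0) :
    Module.finrank ℚ N = Module.finrank ℤ M := by
  obtain rfl : inst = AddCommGroup.toIntModule M := Subsingleton.elim _ _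
  have hunit : ∀ k : nonZeroDivisors ℤ, IsUnit (algebraMap ℤ (Module.End ℤ N) k) := fun k ↦ by
    have hk : ((k : ℤ) : ℚ) ≠ 0 := Int.cast_ne_zero.2 (nonZeroDivisors.coe_ne_zero k)
    have hkz : ∀ z : N, (k : ℤ) • z = ((k : ℤ) : ℚ) • z := fun z ↦
      (Int.cast_smul_eq_zsmul ℚ (k : ℤ) z).symm
    rw [Module.End.isUnit_iff]
    refine ⟨fun x y hxy ↦ ?_, fun y ↦ ⟨((k : ℤ) : ℚ)⁻¹ • y, ?_⟩⟩
    · have : ((k : ℤ) : ℚ) • x = ((k : ℤ) : ℚ) • y := by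
        rw [← hkz, ← hkz]
        exact hxy
      exact smul_right_injective N hk this
    · change (k : ℤ) • (((k : ℤ) : ℚ)⁻¹ • y) = y
      rw [hkz, smul_inv_smul₀ hk]
  have : IsLocalizedModule (nonZeroDivisors ℤ) (φ.toIntLinearMap : M →ₗ[ℤ] N) :=
    { map_units := hunit
      surj := fun y ↦ by
        obtain ⟨k, hk, x, hx⟩ := h1 y
        exact ⟨(x, ⟨k, mem_nonZeroDivisors_of_ne_zero hk⟩), hx.symm⟩
      exists_of_eq := fun {x y} hxy ↦ by
        obtain ⟨k, hk, hkx⟩ := h2 (x - y) (by rw [map_sub, sub_eq_zero]; exact hxy)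
        exact ⟨⟨k, mem_nonZeroDivisors_of_ne_zero hk⟩, by
          rw [zsmul_sub, sub_eq_zero] at hkx; exact hkx⟩ }
  rw [← IsLocalizedModule.finrank_eq (nonZeroDivisors ℤ) (φ.toIntLinearMap : M →ₗ[ℤ] N) le_rfl,
    IsLocalization.finrank_eq ℚ (nonZeroDivisors ℤ) le_rfl]

/-- A homomorphism from a complex of abelian groups to a complex of rational vector spaces that is,
in every degree, the embedding of a lattice. -/
structure IsRationalization {ι : Type*} {c : ComplexShape ι}
    (K : HomologicalComplex (ModuleCat.{w} ℤ) c) (L : HomologicalComplex (ModuleCat.{v} ℚ) c)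
    (φ : ∀ i, K.X i →+ L.X i) : Prop where
  comm : ∀ i j, c.Rel i j → ∀ x, φ j ((K.d i j).hom x) = (L.d i j).hom (φ i x)
  injective : ∀ i, Function.Injective (φ i)
  exists_eq_smul : ∀ i y, ∃ k : ℤ, k ≠ 0 ∧ ∃ x, φ i x = k • y

theorem IsRationalization.finrank_homology {K : HomologicalComplex (ModuleCat.{w} ℤ) c}
    {L : HomologicalComplex (ModuleCat.{v} ℚ) c} {φ : ∀ i, K.X i →+ L.X i}
    (h : IsRationalization K L φ) (j : ι) :
    Module.finrank ℚ (L.homology j) = Module.finrank ℤ (K.homology j) := by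
  have comm : ∀ i j x, φ j ((K.d i j).hom x) = (L.d i j).hom (φ i x) := fun i j x ↦ by
    by_cases hij : c.Rel i j
    · exact h.comm i j hij x
    · simp [K.shape i j hij, L.shape i j hij]
  set i := c.prev j
  set k := c.next j
  rw [(homologyEquiv L i j k rfl rfl).finrank_eq,
    finrank_int_congr (inst' := AddCommGroup.toIntModule _) (homologyAddEquiv K i j k rfl rfl)]
  let ψ : (K.d j k).hom.toAddMonoidHom.ker →+ LinearMap.ker (L.d j k).hom :=
    { toFun x := ⟨φ j x.1, by
        rw [LinearMap.mem_ker, ← comm, show (K.d j k).hom x.1 = 0 from x.2, map_zero]⟩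
      map_zero' := Subtype.ext (map_zero _)
      map_add' x y := Subtype.ext (map_add _ _ _) }
  have hψ : (K.d i j).hom.toAddMonoidHom.range.addSubgroupOf (K.d j k).hom.toAddMonoidHom.ker ≤
      (((LinearMap.range (L.d i j).hom).submoduleOf
        (LinearMap.ker (L.d j k).hom)).toAddSubgroup).comap ψ := by
    rintro x ⟨y, hy⟩
    exact ⟨φ i y, (comm i j y).symm.trans (congrArg (φ j) hy)⟩
  refine finrank_eq_of_rational (QuotientAddGroup.map _ _ ψ hψ) ?_ ?_
  · intro y
    obtain ⟨⟨y, hy⟩, rfl⟩ := Submodule.Quotient.mk_surjective _ y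
    obtain ⟨m, hm, x, hx⟩ := h.exists_eq_smul j y
    refine ⟨m, hm, QuotientAddGroup.mk ⟨x, ?_⟩, ?_⟩
    · refine h.injective k ?_
      refine (comm j k x).trans ?_
      rw [hx, map_zsmul, LinearMap.mem_ker.1 hy, smul_zero, map_zero]
    · exact congrArg Submodule.Quotient.mk (Subtype.ext hx : ψ ⟨x, _⟩ = m • ⟨y, hy⟩)
  · intro x hx
    obtain ⟨⟨x, hx'⟩, rfl⟩ := QuotientAddGroup.mk_surjective x
    obtain ⟨z, hz⟩ := (Submodule.Quotient.mk_eq_zero _).1 hx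
    obtain ⟨m, hm, u, hu⟩ := h.exists_eq_smul i z
    refine ⟨m, hm, ?_⟩
    rw [← QuotientAddGroup.mk_zsmul, QuotientAddGroup.eq_zero_iff]
    refine ⟨u, h.injective j ?_⟩
    refine (comm i j u).trans ?_
    rw [hu, map_zsmul, hz]
    exact (map_zsmul (φ j) m x).symm

end Complexes

section FinitelyGenerated

variable {p : ℕ}

theorem mulIndex_prod (A B : Type*) [AddCommGroup A] [AddCommGroup B] :
    mulIndex p (A × B) = mulIndex p A * mulIndex p B := by
  rw [mulIndex, mulIndex, mulIndex, ← AddSubgroup.index_prod]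
  congr 1
  ext ⟨a, b⟩
  simp only [AddMonoidHom.mem_range, nsmulAddMonoidHom_apply, Prod.exists, Prod.smul_mk,
    Prod.mk.injEq, AddSubgroup.mem_prod]
  exact ⟨fun ⟨x, y, hx, hy⟩ ↦ ⟨⟨x, hx⟩, ⟨y, hy⟩⟩, fun ⟨⟨x, hx⟩, ⟨y, hy⟩⟩ ↦ ⟨x, y, hx, hy⟩⟩

theorem torsionCard_prod (A B : Type*) [AddCommGroup A] [AddCommGroup B] :
    torsionCard p (A × B) = torsionCard p A * torsionCard p B := by
  rw [torsionCard, torsionCard, torsionCard, ← Nat.card_prod]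
  refine Nat.card_congr ⟨fun x ↦ (⟨x.1.1, congrArg Prod.fst x.2⟩, ⟨x.1.2, congrArg Prod.snd x.2⟩),
    fun x ↦ ⟨(x.1.1, x.2.1), Prod.ext x.1.2 x.2.2⟩, fun _ ↦ rfl, fun _ ↦ rfl⟩

theorem mulIndex_eq_torsionCard_of_finite (A : Type*) [AddCommGroup A] [Finite A] :
    mulIndex p A = torsionCard p A := by
  have h1 := (nsmulAddMonoidHom p : A →+ A).range.index_mul_card
  have h2 := (nsmulAddMonoidHom p : A →+ A).ker.card_mul_index
  rw [AddSubgroup.index_ker] at h2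
  exact Nat.eq_of_mul_eq_mul_right Nat.card_pos (h1.trans h2.symm)

theorem mulIndex_finsupp_int [NeZero p] (n : ℕ) : mulIndex p (Fin n →₀ ℤ) = p ^ n := by
  let q : (Fin n →₀ ℤ) →+ (Fin n → ZMod p) :=
    { toFun f i := (f i : ZMod p)
      map_zero' := by ext; simp
      map_add' f g := by ext; simp }
  have hq : Function.Surjective q := fun g ↦
    ⟨Finsupp.equivFunOnFinite.symm fun i ↦ (g i).val, by ext i; simp [q]⟩
  have hker : (nsmulAddMonoidHom p : (Fin n →₀ ℤ) →+ _).range = q.ker := by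
    ext f
    simp only [AddMonoidHom.mem_range, AddMonoidHom.mem_ker, nsmulAddMonoidHom_apply]
    constructor
    · rintro ⟨g, rfl⟩
      ext i
      simp [q]
    · intro hf
      have h : ∀ i, (p : ℤ) ∣ f i := fun i ↦
        (ZMod.intCast_zmod_eq_zero_iff_dvd _ _).1 (congrFun hf i)
      choose g hg using h
      exact ⟨Finsupp.equivFunOnFinite.symm g, by ext i; simp [hg i]⟩
  rw [mulIndex, hker, AddSubgroup.index_ker, AddMonoidHom.range_eq_top.2 hq]
  simp [Nat.card_eq_fintype_card]

theorem torsionCard_of_torsionFree (A : Type*) [AddCommGroup A]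
    (h : ∀ a : A, p • a = 0 → a = 0) : torsionCard p A = 1 := by
  have : (nsmulAddMonoidHom p : A →+ A).ker = ⊥ := (AddSubgroup.eq_bot_iff_forall _).2 h
  rw [torsionCard, this]
  simp

/-- For a finitely generated abelian group, `|A/pA| = p ^ rank A * |A[p]|`. -/
theorem mulIndex_eq [NeZero p] (A : Type*) [AddCommGroup A] {inst : Module ℤ A} [Module.Finite ℤ A] :
    mulIndex p A = p ^ Module.finrank ℤ A * torsionCard p A := by
  obtain rfl : inst = AddCommGroup.toIntModule A := Subsingleton.elim _ _
  have : AddGroup.FG A := Module.Finite.iff_addGroup_fg.1 inferInstance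
  obtain ⟨n, ι, _, q, hq, k, ⟨e⟩⟩ := AddCommGroup.equiv_free_prod_directSum_zmod A
  set T := DirectSum ι fun i ↦ ZMod (q i ^ k i)
  have : ∀ i, NeZero (q i ^ k i) := fun i ↦ ⟨pow_ne_zero _ (hq i).ne_zero⟩
  have : Finite T := Finite.of_equiv _ (DirectSum.addEquivProd fun i ↦ ZMod (q i ^ k i)).symm.toEquiv
  have hT : Module.IsTorsion ℤ T := isAddTorsion_iff_isTorsion_int.1 isAddTorsion_of_finite
  have hrank : Module.finrank ℤ A = n := by
    let f : A →ₗ[ℤ] (Fin n →₀ ℤ) := LinearMap.fst ℤ _ T ∘ₗ e.toIntLinearEquiv.toLinearMap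
    have hf : Function.Surjective f := Prod.fst_surjective.comp e.surjective
    have hker : Module.IsTorsion ℤ (LinearMap.ker f) := by
      rintro ⟨x, hx⟩
      obtain ⟨m, hm⟩ := @hT (e x).2
      refine ⟨m, Subtype.ext (e.injective (Prod.ext ?_ ?_))⟩
      · have h1 : (e x).1 = 0 := hx
        change (e ((m : ℤ) • x)).1 = (e 0).1
        rw [map_zsmul, Prod.smul_fst, h1, smul_zero, map_zero, Prod.fst_zero]
      · change (e ((m : ℤ) • x)).2 = (e 0).2
        rw [map_zsmul, map_zero]
        exact hm
    rw [← Submodule.finrank_quotient_add_finrank (LinearMap.ker f),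
      (f.quotKerEquivOfSurjective hf).finrank_eq, Module.finrank_eq_zero_iff_isTorsion.2 hker]
    simp
  rw [mulIndex_congr e, torsionCard_congr e, mulIndex_prod, torsionCard_prod, hrank,
    mulIndex_finsupp_int, mulIndex_eq_torsionCard_of_finite,
    torsionCard_of_torsionFree (Fin n →₀ ℤ) (fun a ha ↦ by simpa [NeZero.ne p] using ha), one_mul]

/-- The `p`-torsion of a finitely generated abelian group is a finite `p`-group. -/
theorem exists_torsionCard_eq [Fact p.Prime] (A : Type*) [AddCommGroup A] {inst : Module ℤ A}
    [Module.Finite ℤ A] : ∃ t, torsionCard p A = p ^ t := by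
  obtain rfl : inst = AddCommGroup.toIntModule A := Subsingleton.elim _ _
  let T := (nsmulAddMonoidHom p : A →+ A).ker
  let : Module (ZMod p) T := AddCommGroup.zmodModule fun x ↦ Subtype.ext x.2
  have : Module.Finite ℤ T := inferInstanceAs (Module.Finite ℤ (AddSubgroup.toIntSubmodule T))
  have : Module.Finite (ZMod p) T := Module.Finite.of_restrictScalars_finite ℤ _ _
  exact ⟨Module.finrank (ZMod p) T, by
    rw [torsionCard, Module.natCard_eq_pow_finrank (K := ZMod p), Nat.card_zmod]⟩

end FinitelyGenerated

section Telescope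

/-- The telescoping argument that compares the two Euler characteristics. -/
theorem finsum_alternating_eq (a b t : ℕ → ℕ) (h0 : b 0 = a 0 + t 0)
    (hs : ∀ n, b (n + 1) = a (n + 1) + t (n + 1) + t n) (N : ℕ) (ha : ∀ n, N ≤ n → a n = 0)
    (hb : ∀ n, N ≤ n → b n = 0) :
    ∑ᶠ n : ℕ, (-1 : ℤ) ^ n * (a n : ℤ) = ∑ᶠ n : ℕ, (-1 : ℤ) ^ n * (b n : ℤ) := by
  have ht : t N = 0 := by
    have := hs N
    rw [hb (N + 1) (by omega)] at this
    omega
  have hsum : ∀ c : ℕ → ℕ, (∀ n, N ≤ n → c n = 0) →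
      ∑ᶠ n : ℕ, (-1 : ℤ) ^ n * (c n : ℤ) = ∑ n ∈ Finset.range (N + 1), (-1 : ℤ) ^ n * (c n : ℤ) := by
    intro c hc
    refine finsum_eq_sum_of_support_subset _ fun n hn ↦ ?_
    by_contra h
    refine hn ?_
    simp only [Finset.coe_range, Set.mem_Iio, not_lt] at h
    simp [hc n (by omega)]
  have key : ∀ m, ∑ n ∈ Finset.range (m + 1), (-1 : ℤ) ^ n * (b n : ℤ) =
      ∑ n ∈ Finset.range (m + 1), (-1 : ℤ) ^ n * (a n : ℤ) + (-1) ^ m * (t m : ℤ) := by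
    intro m
    induction m with
    | zero => simp [h0]
    | succ m ih =>
      rw [Finset.sum_range_succ, ih, Finset.sum_range_succ _ (m + 1), hs]
      push_cast
      ring
  rw [hsum a ha, hsum b hb, key N, ht]
  simp

end Telescope

section Regular

variable (K : Type v) [CommRing K] (V : Type u)

theorem degenerate_eq_supported (n : ℕ) :
    degenerate K V n =
      Finsupp.supported K K {x : Fin (n + 1) → V | ∃ i : Fin n, x i.castSucc = x i.succ} := by
  rw [Finsupp.supported_eq_span_single, degenerate]
  congr 1
  ext e
  simp [tuple, Set.mem_image, eq_comm]

end Regular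

section Path

variable (K : Type v) [CommRing K] {V : Type u} (G : Digraph V)

theorem pathComplex_d (n : ℕ) :
    (pathComplex K G).d (n + 1) n = ModuleCat.ofHom (pathBoundary K G n) := by
  simp [pathComplex]

theorem finite_homology {R : Type*} [Ring R] [IsNoetherianRing R] {ι : Type*} {c : ComplexShape ι}
    (C : HomologicalComplex (ModuleCat.{w} R) c) (i : ι) [Module.Finite R (C.X i)] :
    Module.Finite R (C.homology i) :=
  Module.Finite.equiv (homologyEquiv C _ i _ rfl rfl).symm

instance [IsNoetherianRing K] [Finite V] (n : ℕ) : Module.Finite K ((pathComplex K G).X n) :=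
  inferInstanceAs (Module.Finite K (pathChains K G n))

instance [IsNoetherianRing K] [Finite V] (n : ℤ) : Module.Finite K (pathHomology K G n) := by
  cases n with
  | ofNat n => exact finite_homology _ _
  | negSucc n => exact inferInstanceAs (Module.Finite K PUnit.{max u v + 1})

end Path

section Rational

variable {V : Type u} 

/-- The embedding of the integral tuples into the rational tuples. -/
def tuplesRat (V : Type u) (n : ℕ) : Tuples ℤ V n →+ Tuples ℚ V n :=
  Finsupp.mapRange.addMonoidHom (Int.castAddHom ℚ)

theorem tuplesRat_tuple {n : ℕ} (x : Fin (n + 1) → V) : tuplesRat V n (tuple ℤ x) = tuple ℚ x := by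
  simp [tuplesRat, tuple]

theorem tuplesRat_boundary (n : ℕ) (y : Tuples ℤ V (n + 1)) :
    tuplesRat V n (tuplesBoundary ℤ V n y) = tuplesBoundary ℚ V n (tuplesRat V (n + 1) y) := by
  induction y using Finsupp.induction_linear with
  | zero => simp
  | add f g hf hg => simp only [map_add, hf, hg]
  | single x a =>
    have h : Finsupp.single x a = a • tuple ℤ x := by simp [tuple]
    rw [h, map_zsmul, map_zsmul, map_zsmul, map_zsmul, tuplesRat_tuple, tuplesBoundary_tuple,
      tuplesBoundary_tuple, map_sum]
    congr 1
    refine Finset.sum_congr rfl fun i _ ↦ ?_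
    rcases neg_one_pow_eq_or ℤ (i : ℕ) with h | h <;> rcases Nat.even_or_odd (i : ℕ) with h' | h' <;>
      simp [tuplesRat_tuple, h'.neg_one_pow]

theorem tuplesRat_mem_degenerate {n : ℕ} (y : Tuples ℤ V n) :
    tuplesRat V n y ∈ degenerate ℚ V n ↔ y ∈ degenerate ℤ V n := by
  simp [degenerate_eq_supported, Finsupp.mem_supported', tuplesRat]

/-- The embedding of the integral regular chains into the rational regular chains. -/
def regularRat (V : Type u) (n : ℕ) : Regular ℤ V n →+ Regular ℚ V n :=
  QuotientAddGroup.map (degenerate ℤ V n).toAddSubgroup (degenerate ℚ V n).toAddSubgroup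
    (tuplesRat V n) fun y hy ↦ (tuplesRat_mem_degenerate y).2 hy

theorem regularRat_mkQ {n : ℕ} (y : Tuples ℤ V n) :
    regularRat V n ((degenerate ℤ V n).mkQ y) = (degenerate ℚ V n).mkQ (tuplesRat V n y) := rfl

theorem regularRat_injective (n : ℕ) : Function.Injective (regularRat V n) := by
  refine (injective_iff_map_eq_zero _).2 fun x hx ↦ ?_
  obtain ⟨y, rfl⟩ := Submodule.mkQ_surjective _ x
  rw [regularRat_mkQ, Submodule.mkQ_apply, Submodule.Quotient.mk_eq_zero,
    tuplesRat_mem_degenerate] at hx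
  exact (Submodule.Quotient.mk_eq_zero _).2 hx

theorem regularRat_boundary (n : ℕ) (x : Regular ℤ V (n + 1)) :
    regularRat V n (regularBoundary ℤ V n x) = regularBoundary ℚ V n (regularRat V (n + 1) x) := by
  obtain ⟨y, rfl⟩ := Submodule.mkQ_surjective _ x
  exact congrArg (degenerate ℚ V n).mkQ (tuplesRat_boundary n y)

variable (G : Digraph V)

theorem regularRat_mem_allowed {n : ℕ} {x : Regular ℤ V n} (hx : x ∈ allowed ℤ G n) :
    regularRat V n x ∈ allowed ℚ G n := by
  induction hx using Submodule.span_induction with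
  | mem x hx =>
    obtain ⟨y, hy, rfl⟩ := hx
    exact Submodule.subset_span ⟨y, hy, by rw [regularRat_mkQ, tuplesRat_tuple]⟩
  | zero => simp
  | add x y _ _ hx hy => rw [map_add]; exact add_mem hx hy
  | smul a x _ hx => rw [map_zsmul]; exact zsmul_mem hx a

theorem exists_regularRat_eq_of_mem_allowed {n : ℕ} {y : Regular ℚ V n} (hy : y ∈ allowed ℚ G n) :
    ∃ k : ℤ, k ≠ 0 ∧ ∃ x ∈ allowed ℤ G n, regularRat V n x = k • y := by
  induction hy using Submodule.span_induction with
  | mem x hx =>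
    obtain ⟨y, hy, rfl⟩ := hx
    exact ⟨1, one_ne_zero, _, Submodule.subset_span ⟨y, hy, rfl⟩, by
      rw [regularRat_mkQ, tuplesRat_tuple, one_smul]⟩
  | zero => exact ⟨1, one_ne_zero, 0, zero_mem _, by simp⟩
  | add x y _ _ hx hy =>
    obtain ⟨k, hk, x', hx', h1⟩ := hx
    obtain ⟨l, hl, y', hy', h2⟩ := hy
    refine ⟨k * l, mul_ne_zero hk hl, l • x' + k • y',
      add_mem (zsmul_mem hx' l) (zsmul_mem hy' k), ?_⟩
    rw [map_add, map_zsmul, map_zsmul, h1, h2, smul_add, smul_smul, smul_smul, mul_comm l k]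
  | smul a x _ hx =>
    obtain ⟨k, hk, x', hx', h1⟩ := hx
    refine ⟨a.den * k, mul_ne_zero (by simp) hk, a.num • x', zsmul_mem hx' _, ?_⟩
    rw [map_zsmul, h1, ← Int.cast_smul_eq_zsmul ℚ, ← Int.cast_smul_eq_zsmul ℚ,
      ← Int.cast_smul_eq_zsmul ℚ, smul_smul, smul_smul]
    congr 1
    push_cast
    rw [mul_right_comm, Rat.den_mul_eq_num]

theorem regularRat_mem_pathChains {n : ℕ} {x : Regular ℤ V n} (hx : x ∈ pathChains ℤ G n) :
    regularRat V n x ∈ pathChains ℚ G n := by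
  cases n with
  | zero => exact regularRat_mem_allowed G hx
  | succ n =>
    refine ⟨regularRat_mem_allowed G hx.1, ?_⟩
    change regularBoundary ℚ V n _ ∈ allowed ℚ G n
    rw [← regularRat_boundary]
    exact regularRat_mem_allowed G hx.2

theorem exists_regularRat_eq_of_mem_pathChains {n : ℕ} {y : Regular ℚ V n}
    (hy : y ∈ pathChains ℚ G n) :
    ∃ k : ℤ, k ≠ 0 ∧ ∃ x ∈ pathChains ℤ G n, regularRat V n x = k • y := by
  cases n with
  | zero => exact exists_regularRat_eq_of_mem_allowed G hy
  | succ n =>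
    obtain ⟨k, hk, x, hx, h1⟩ := exists_regularRat_eq_of_mem_allowed G hy.1
    obtain ⟨l, hl, z, hz, h2⟩ := exists_regularRat_eq_of_mem_allowed G hy.2
    refine ⟨l * k, mul_ne_zero hl hk, l • x, ⟨zsmul_mem hx l, ?_⟩, by
      rw [map_zsmul, h1, smul_smul]⟩
    have h3 : regularBoundary ℤ V n (l • x) = k • z := by
      refine regularRat_injective n ?_
      rw [regularRat_boundary, map_zsmul, map_zsmul, map_zsmul, h1, h2, map_zsmul,
        smul_comm]
    change regularBoundary ℤ V n (l • x) ∈ allowed ℤ G n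
    rw [h3]
    exact zsmul_mem hz k

/-- The embedding of the integral path chains into the rational path chains. -/
def pathChainsRat (n : ℕ) : (pathComplex ℤ G).X n →+ (pathComplex ℚ G).X n :=
  ((regularRat V n).comp (pathChains ℤ G n).toAddSubgroup.subtype).codRestrict
    (pathChains ℚ G n).toAddSubgroup fun x ↦ regularRat_mem_pathChains G x.2

theorem isRationalization_pathComplex :
    IsRationalization (pathComplex ℤ G) (pathComplex ℚ G) (pathChainsRat G) where
  comm := by
    rintro _ n rfl x
    rw [pathComplex_d, pathComplex_d]
    exact Subtype.ext (regularRat_boundary n x.1)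
  injective n x y hxy := Subtype.ext (regularRat_injective n (congrArg Subtype.val hxy))
  exists_eq_smul n y := by
    obtain ⟨k, hk, x, hx, h⟩ := exists_regularRat_eq_of_mem_pathChains G y.2
    exact ⟨k, hk, ⟨x, hx⟩, Subtype.ext h⟩

theorem finrank_pathHomology_rat (n : ℕ) :
    Module.finrank ℚ (pathHomology ℚ G n) = Module.finrank ℤ (pathHomology ℤ G n) :=
  (isRationalization_pathComplex G).finrank_homology n

end Rational

section Euler

variable {V : Type u} (G : Digraph V)

theorem exists_finrank_eq_zero {F : Type v} [Field F] (h : PathEulerDefined F G) :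
    ∃ N : ℕ, ∀ n : ℕ, N ≤ n → Module.finrank F (pathHomology F G n) = 0 := by
  obtain ⟨N, hN⟩ := h.bddAbove
  refine ⟨(N + 1).toNat, fun n hn ↦ ?_⟩
  by_contra h0
  have h1 : ¬ Subsingleton (pathHomology F G n) := fun _ ↦ h0 Module.finrank_zero_of_subsingleton
  have := hN h1
  omega

/-- If the universal coefficient count holds for the path homology, with respect to finitely
generated abelian groups `A n` of the right rank, the Euler characteristics agree. -/
theorem pathEuler_eq_of_card [Finite V] (p : ℕ) [Fact p.Prime] (hQ : PathEulerDefined ℚ G)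
    (hp : PathEulerDefined (ZMod p) G) (A : ℕ → Type*) [∀ n, AddCommGroup (A n)]
    {inst : ∀ n, Module ℤ (A n)} [∀ n, Module.Finite ℤ (A n)]
    (hr : ∀ n : ℕ, Module.finrank ℚ (pathHomology ℚ G n) = Module.finrank ℤ (A n))
    (h0 : Nat.card (pathHomology (ZMod p) G (0 : ℕ)) = mulIndex p (A 0))
    (hs : ∀ n : ℕ, Nat.card (pathHomology (ZMod p) G (n + 1 : ℕ)) =
      mulIndex p (A (n + 1)) * torsionCard p (A n)) :
    pathEuler ℚ G = pathEuler (ZMod p) G := by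
  have hp1 := (Fact.out : p.Prime).one_lt
  choose t ht using fun n ↦ exists_torsionCard_eq (p := p) (A n)
  obtain ⟨N, hN⟩ := exists_finrank_eq_zero G hQ
  obtain ⟨M, hM⟩ := exists_finrank_eq_zero G hp
  have hcard : ∀ n : ℕ, Nat.card (pathHomology (ZMod p) G n) =
      p ^ Module.finrank (ZMod p) (pathHomology (ZMod p) G n) := fun n ↦ by
    rw [Module.natCard_eq_pow_finrank (K := ZMod p), Nat.card_zmod]
  refine finsum_alternating_eq _ _ t ?_ (fun n ↦ ?_) (max N M)
    (fun n hn ↦ hN n (le_trans (le_max_left _ _) hn))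
    (fun n hn ↦ hM n (le_trans (le_max_right _ _) hn))
  · rw [hcard, mulIndex_eq, ht, ← pow_add] at h0
    rw [hr]
    exact Nat.pow_right_injective hp1 h0
  · have := hs n
    rw [hcard, mulIndex_eq, ht, ht, ← pow_add, ← pow_add] at this
    rw [hr]
    exact Nat.pow_right_injective hp1 this

end Euler

section TensorProduct
open TensorProduct

variable {M : Type w} [AddCommGroup M] {instM : Module ℤ M}

theorem one_tmul_injective {S : Type*} [CommRing S] [CharZero S] {inst : Module ℤ S}
    [Module.Flat ℤ M] : Function.Injective fun x : M ↦ (1 : S) ⊗ₜ[ℤ] x := by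
  obtain rfl : inst = AddCommGroup.toIntModule S := Subsingleton.elim _ _
  have h := Module.Flat.rTensor_preserves_injective_linearMap (M := M)
    (LinearMap.toSpanSingleton ℤ S 1) (by
      intro a b hab
      simpa using hab)
  intro x y hxy
  refine (TensorProduct.lid ℤ M).symm.injective (h ?_)
  simpa using hxy

theorem exists_one_tmul_eq {inst : Module ℤ ℚ} (y : ℚ ⊗[ℤ] M) :
    ∃ k : ℤ, k ≠ 0 ∧ ∃ x : M, (1 : ℚ) ⊗ₜ[ℤ] x = k • y := by
  obtain rfl : inst = AddCommGroup.toIntModule ℚ := Subsingleton.elim _ _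
  obtain rfl : instM = AddCommGroup.toIntModule M := Subsingleton.elim _ _
  induction y with
  | zero => exact ⟨1, one_ne_zero, 0, by simp⟩
  | tmul q x =>
    refine ⟨q.den, by simp, q.num • x, ?_⟩
    rw [TensorProduct.tmul_smul, TensorProduct.smul_tmul', TensorProduct.smul_tmul']
    congr 1
    simp [mul_comm]
  | add y z hy hz =>
    obtain ⟨k, hk, y', hy'⟩ := hy
    obtain ⟨l, hl, z', hz'⟩ := hz
    refine ⟨k * l, mul_ne_zero hk hl, l • y' + k • z', ?_⟩
    rw [TensorProduct.tmul_add, TensorProduct.tmul_smul, TensorProduct.tmul_smul, hy', hz',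
      smul_add, smul_smul, smul_smul, mul_comm l k]

variable {p : ℕ}

theorem exact_int_zmod : Function.Exact (LinearMap.lsmul ℤ ℤ (p : ℤ))
    (LinearMap.toSpanSingleton ℤ (ZMod p) 1) := by
  intro x
  simp only [LinearMap.toSpanSingleton_apply, zsmul_one, ZMod.intCast_zmod_eq_zero_iff_dvd]
  exact ⟨fun ⟨y, hy⟩ ↦ ⟨y, by simp [hy]⟩, fun ⟨y, hy⟩ ↦ ⟨y, by simp [← hy]⟩⟩

theorem toSpanSingleton_zmod_surjective :
    Function.Surjective (LinearMap.toSpanSingleton ℤ (ZMod p) 1) := fun x ↦ by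
  obtain ⟨n, rfl⟩ := ZMod.intCast_surjective x
  exact ⟨n, by simp⟩

theorem one_tmul_zmod_surjective {inst : Module ℤ (ZMod p)} :
    Function.Surjective fun x : M ↦ (1 : ZMod p) ⊗ₜ[ℤ] x := by
  obtain rfl : inst = AddCommGroup.toIntModule (ZMod p) := Subsingleton.elim _ _
  have h := LinearMap.rTensor_surjective M (toSpanSingleton_zmod_surjective (p := p))
  intro y
  obtain ⟨z, rfl⟩ := h y
  obtain ⟨x, rfl⟩ := (TensorProduct.lid ℤ M).symm.surjective z
  exact ⟨x, by simp⟩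

theorem one_tmul_zmod_eq_zero_iff {inst : Module ℤ (ZMod p)} (x : M) :
    (1 : ZMod p) ⊗ₜ[ℤ] x = 0 ↔ ∃ y, p • y = x := by
  obtain rfl : inst = AddCommGroup.toIntModule (ZMod p) := Subsingleton.elim _ _
  obtain rfl : instM = AddCommGroup.toIntModule M := Subsingleton.elim _ _
  have h := rTensor_exact M (exact_int_zmod (p := p)) toSpanSingleton_zmod_surjective
    ((TensorProduct.lid ℤ M).symm x)
  simp only [TensorProduct.lid_symm_apply, LinearMap.rTensor_tmul,
    LinearMap.toSpanSingleton_apply, one_smul] at h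
  rw [h]
  constructor
  · rintro ⟨z, hz⟩
    obtain ⟨y, rfl⟩ := (TensorProduct.lid ℤ M).symm.surjective z
    refine ⟨y, ?_⟩
    have := congrArg (TensorProduct.lid ℤ M) hz
    simpa using this
  · rintro ⟨y, rfl⟩
    exact ⟨(1 : ℤ) ⊗ₜ y, (TensorProduct.lid ℤ M).injective (by simp)⟩

theorem eq_zero_of_nsmul_eq_zero_of_free [Module.Free ℤ M] (hp : p ≠ 0) {x : M}
    (hx : p • x = 0) : x = 0 := by
  obtain rfl : instM = AddCommGroup.toIntModule M := Subsingleton.elim _ _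
  rw [← natCast_zsmul] at hx
  exact (smul_eq_zero.1 hx).resolve_left (by exact_mod_cast hp)

end TensorProduct

section TensorComplex

variable (C : ChainComplex (ModuleCat.{w} ℤ) ℤ)

/-- The homomorphism `x ↦ 1 ⊗ x` from a complex to its tensor product with a ring. -/
def toTensorComplex (K : Type) [CommRing K] (i : ℤ) : C.X i →+ (tensorComplex C K).X i :=
  { toFun x := (TensorProduct.mk ℤ ((ModuleCat.restrictScalars (algebraMap ℤ K)).obj
      (ModuleCat.of K K)) (C.X i) (1 : K)) x
    map_zero' := map_zero _
    map_add' := map_add _ }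

theorem toTensorComplex_d (K : Type) [CommRing K] (i j : ℤ) (x : C.X i) :
    toTensorComplex C K j ((C.d i j).hom x) =
      ((tensorComplex C K).d i j).hom (toTensorComplex C K i x) := rfl

variable [∀ n, Module.Free ℤ (C.X n)]

theorem isRationalization_tensorComplex :
    IsRationalization C (tensorComplex C ℚ) (toTensorComplex C ℚ) where
  comm i j _ x := toTensorComplex_d C ℚ i j x
  injective _ := one_tmul_injective (S := ℚ)
  exists_eq_smul _ y := exists_one_tmul_eq y

theorem isReduction_tensorComplex (p : ℕ) [NeZero p] :
    IsReduction p C (tensorComplex C (ZMod p)) (toTensorComplex C (ZMod p)) where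
  comm i j _ x := toTensorComplex_d C _ i j x
  surjective _ := one_tmul_zmod_surjective
  eq_zero_iff _ x := one_tmul_zmod_eq_zero_iff x
  torsionFree _ _ hx :=
    eq_zero_of_nsmul_eq_zero_of_free (NeZero.ne p) hx

/-- There is no chain complex of free abelian groups with homology of finite type whose homology
with rational coefficients and with coefficients modulo `p` is the path homology, unless the
Euler characteristics agree. -/
theorem pathEuler_eq_of_chainComplex {V : Type} [Finite V] (G : Digraph V) (p : ℕ) [Fact p.Prime]
    (hQ : PathEulerDefined ℚ G) (hp : PathEulerDefined (ZMod p) G)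
    (hC : ∀ n : ℤ, Module.Finite ℤ (C.homology n))
    (h1 : ∀ n : ℤ, Nonempty (pathHomology ℚ G n ≃ₗ[ℚ] (tensorComplex C ℚ).homology n))
    (h2 : ∀ n : ℤ, Nonempty (pathHomology (ZMod p) G n ≃ₗ[ZMod p]
      (tensorComplex C (ZMod p)).homology n)) :
    pathEuler ℚ G = pathEuler (ZMod p) G := by
  have hcard : ∀ n : ℤ, Nat.card (pathHomology (ZMod p) G (n + 1)) =
      mulIndex p (C.homology (n + 1)) * torsionCard p (C.homology n) := fun n ↦ by
    rw [Nat.card_congr (h2 (n + 1)).some.toEquiv]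
    exact (isReduction_tensorComplex C p).card_homology (i := n + 1) (j := n) rfl
  have hneg : torsionCard p (C.homology (-1)) = 1 := by
    have h := hcard (-2)
    have h1 : Nat.card (pathHomology (ZMod p) G (-2 + 1)) = 1 := Nat.card_unique (α := PUnit)
    rw [h1] at h
    have h3 := Nat.eq_one_of_mul_eq_one_right h.symm
    rw [mulIndex_eq] at h3
    exact Nat.eq_one_of_mul_eq_one_left h3
  refine pathEuler_eq_of_card G p hQ hp (fun n ↦ C.homology n) (fun n ↦ ?_) ?_ fun n ↦ hcard n
  · rw [(h1 n).some.finrank_eq, (isRationalization_tensorComplex C).finrank_homology]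
  · have h := hcard (-1)
    rw [hneg, mul_one] at h
    exact h

end TensorComplex

section FreeChains

variable {X : Type w}

/-- The change of coefficients on finitely supported functions. -/
def coeffMap (K : Type) [CommRing K] (X : Type w) : (X →₀ ULift.{w} ℤ) →+ (X →₀ ULift.{w} K) :=
  Finsupp.mapRange.addMonoidHom
    (AddEquiv.ulift.symm.toAddMonoidHom.comp
      ((Int.castAddHom K).comp AddEquiv.ulift.toAddMonoidHom))

theorem coeffMap_apply (K : Type) [CommRing K] (f : X →₀ ULift.{w} ℤ) (x : X) :
    coeffMap K X f x = ⟨((f x).down : K)⟩ := rfl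

theorem coeffMap_single (K : Type) [CommRing K] (x : X) (a : ULift.{w} ℤ) :
    coeffMap K X (Finsupp.single x a) = Finsupp.single x ⟨(a.down : K)⟩ :=
  Finsupp.mapRange_single (hf := map_zero _)

theorem coeffMap_rat_injective : Function.Injective (coeffMap ℚ X) :=
  Finsupp.mapRange_injective _ (map_zero _) fun a b h ↦ by
    have := congrArg ULift.down h
    exact ULift.ext _ _ (Int.cast_injective this)

theorem exists_coeffMap_rat_eq (y : X →₀ ULift.{w} ℚ) :
    ∃ k : ℤ, k ≠ 0 ∧ ∃ x, coeffMap ℚ X x = k • y := by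
  induction y using Finsupp.induction_linear with
  | zero => exact ⟨1, one_ne_zero, 0, by simp⟩
  | add y z hy hz =>
    obtain ⟨k, hk, y', hy'⟩ := hy
    obtain ⟨l, hl, z', hz'⟩ := hz
    refine ⟨k * l, mul_ne_zero hk hl, l • y' + k • z', ?_⟩
    rw [map_add, map_zsmul, map_zsmul, hy', hz', smul_add, smul_smul, smul_smul, mul_comm l k]
  | single x a =>
    refine ⟨a.down.den, by simp, Finsupp.single x ⟨a.down.num⟩, ?_⟩
    rw [coeffMap_single, Finsupp.smul_single]
    congr 1
    refine ULift.ext _ _ ?_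
    simp

variable {p : ℕ}

theorem coeffMap_zmod_surjective : Function.Surjective (coeffMap (ZMod p) X) :=
  Finsupp.mapRange_surjective _ (map_zero _) fun a ↦ by
    obtain ⟨n, hn⟩ := ZMod.intCast_surjective a.down
    exact ⟨⟨n⟩, ULift.ext _ _ hn⟩

theorem coeffMap_zmod_eq_zero_iff [NeZero p] (f : X →₀ ULift.{w} ℤ) :
    coeffMap (ZMod p) X f = 0 ↔ ∃ g, p • g = f := by
  constructor
  · intro h
    refine ⟨f.mapRange (fun a ↦ ⟨a.down / p⟩) (by ext; simp), ?_⟩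
    ext x
    have hx := congrArg ULift.down (DFunLike.congr_fun h x)
    have : (p : ℤ) ∣ (f x).down := (ZMod.intCast_zmod_eq_zero_iff_dvd _ _).1 hx
    simp [Int.mul_ediv_cancel' this]
  · rintro ⟨g, rfl⟩
    ext x
    simp [coeffMap_apply]

end FreeChains

section SSet
open Simplicial Limits

variable (S : SSet.{w}) (K : Type) [CommRing K]

/-- The simplicial chain complex with coefficients in a ring. -/
abbrev simplicialChains : ChainComplex (ModuleCat.{w} K) ℕ :=
  S.chainComplex (ModuleCat.of K (ULift.{w} K))

/-- The simplicial chains are the finitely supported functions on the simplices. -/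
def chainsIso (n : ℕ) :
    (simplicialChains S K).X n ≅ ModuleCat.of K (S _⦋n⦌ →₀ ULift.{w} K) where
  hom := Cofan.IsColimit.desc (S.isColimitChainComplexXCofan _ n) fun x ↦
    ModuleCat.ofHom (Finsupp.lsingle x)
  inv := ModuleCat.ofHom (Finsupp.lsum K fun x ↦
    (S.ιChainComplex (R := ModuleCat.of K (ULift.{w} K)) x).hom)
  hom_inv_id := by
    refine SSet.chainComplex_hom_ext fun x ↦ ?_
    have h := Cofan.IsColimit.fac (S.isColimitChainComplexXCofan (ModuleCat.of K (ULift.{w} K)) n)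
      (fun x ↦ ModuleCat.ofHom (Finsupp.lsingle x)) x
    refine (Category.assoc _ _ _).symm.trans ?_
    refine (congrArg (· ≫ _) h).trans ?_
    ext a
    exact Finsupp.lsum_single (R := K) K _ x a
  inv_hom_id := by
    ext x a : 3
    have h := Cofan.IsColimit.fac (S.isColimitChainComplexXCofan (ModuleCat.of K (ULift.{w} K)) n)
      (fun x ↦ ModuleCat.ofHom (Finsupp.lsingle x)) x
    refine Eq.trans (congrArg (ModuleCat.Hom.hom _) (Finsupp.lsum_single (R := K) K (fun x ↦
      (S.ιChainComplex (R := ModuleCat.of K (ULift.{w} K)) x).hom) x a)) ?_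
    exact congrArg (fun f ↦ f.hom a) h

theorem ι_chainsIso {n : ℕ} (x : S _⦋n⦌) :
    S.ιChainComplex (R := ModuleCat.of K (ULift.{w} K)) x ≫ (chainsIso S K n).hom =
      ModuleCat.ofHom (Finsupp.lsingle x) :=
  Cofan.IsColimit.fac (S.isColimitChainComplexXCofan (ModuleCat.of K (ULift.{w} K)) n)
    (fun x ↦ ModuleCat.ofHom (Finsupp.lsingle x)) x

/-- The simplicial chains are the finitely supported functions on the simplices. -/
def chainsEquiv (n : ℕ) : (simplicialChains S K).X n ≃ₗ[K] (S _⦋n⦌ →₀ ULift.{w} K) :=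
  (chainsIso S K n).toLinearEquiv

/-- The differential of the simplicial chains on finitely supported functions. -/
def simplicialBoundary (n : ℕ) : (S _⦋n + 1⦌ →₀ ULift.{w} K) →ₗ[K] (S _⦋n⦌ →₀ ULift.{w} K) :=
  ∑ i : Fin (n + 2), (-1 : ℤ) ^ (i : ℕ) • Finsupp.lmapDomain _ K (S.δ i)

theorem chainsEquiv_d (n : ℕ) (x : (simplicialChains S K).X (n + 1)) :
    chainsEquiv S K n (((simplicialChains S K).d (n + 1) n).hom x) =
      simplicialBoundary S K n (chainsEquiv S K (n + 1) x) := by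
  have h : (simplicialChains S K).d (n + 1) n ≫ (chainsIso S K n).hom =
      (chainsIso S K (n + 1)).hom ≫ ModuleCat.ofHom (simplicialBoundary S K n) := by
    refine SSet.chainComplex_hom_ext fun x ↦ ?_
    rw [SSet.ιChainComplex_d_assoc, ← Category.assoc, ι_chainsIso, Preadditive.sum_comp]
    simp only [Preadditive.zsmul_comp, ι_chainsIso]
    ext a
    simp [simplicialBoundary, Finsupp.mapDomain_single]
  exact congrArg (fun f ↦ f.hom x) h

theorem coeffMap_boundary (n : ℕ) (f : S _⦋n + 1⦌ →₀ ULift.{w} ℤ) :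
    coeffMap K _ (simplicialBoundary S ℤ n f) = simplicialBoundary S K n (coeffMap K _ f) := by
  induction f using Finsupp.induction_linear with
  | zero => simp
  | add f g hf hg => simp only [map_add, hf, hg]
  | single x a =>
    simp only [simplicialBoundary, LinearMap.sum_apply, LinearMap.smul_apply, coeffMap_single,
      Finsupp.lmapDomain_apply, Finsupp.mapDomain_single, map_sum, map_zsmul]

/-- The change of coefficients on simplicial chains. -/
def chainsCoeffMap (n : ℕ) : (simplicialChains S ℤ).X n →+ (simplicialChains S K).X n :=
  (chainsEquiv S K n).symm.toLinearMap.toAddMonoidHom.comp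
    ((coeffMap K _).comp (chainsEquiv S ℤ n).toLinearMap.toAddMonoidHom)

theorem chainsEquiv_chainsCoeffMap (n : ℕ) (x : (simplicialChains S ℤ).X n) :
    chainsEquiv S K n (chainsCoeffMap S K n x) = coeffMap K _ (chainsEquiv S ℤ n x) :=
  (chainsEquiv S K n).apply_symm_apply _

theorem chainsCoeffMap_d (i j : ℕ) (hij : (ComplexShape.down ℕ).Rel i j)
    (x : (simplicialChains S ℤ).X i) :
    chainsCoeffMap S K j (((simplicialChains S ℤ).d i j).hom x) =
      ((simplicialChains S K).d i j).hom (chainsCoeffMap S K i x) := by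
  obtain rfl : j + 1 = i := hij
  refine (chainsEquiv S K j).injective ?_
  rw [chainsEquiv_chainsCoeffMap, chainsEquiv_d, chainsEquiv_d, chainsEquiv_chainsCoeffMap,
    coeffMap_boundary]

theorem isRationalization_simplicialChains :
    IsRationalization (simplicialChains S ℤ) (simplicialChains S ℚ) (chainsCoeffMap S ℚ) where
  comm := chainsCoeffMap_d S ℚ
  injective n := (chainsEquiv S ℚ n).symm.injective.comp
    (coeffMap_rat_injective.comp (chainsEquiv S ℤ n).injective)
  exists_eq_smul n y := by
    obtain ⟨k, hk, x, hx⟩ := exists_coeffMap_rat_eq (chainsEquiv S ℚ n y)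
    refine ⟨k, hk, (chainsEquiv S ℤ n).symm x, (chainsEquiv S ℚ n).injective ?_⟩
    rw [chainsEquiv_chainsCoeffMap, LinearEquiv.apply_symm_apply, hx, map_zsmul]

theorem isReduction_simplicialChains (p : ℕ) [NeZero p] :
    IsReduction p (simplicialChains S ℤ) (simplicialChains S (ZMod p))
      (chainsCoeffMap S (ZMod p)) where
  comm := chainsCoeffMap_d S (ZMod p)
  surjective n := (chainsEquiv S (ZMod p) n).symm.surjective.comp
    (coeffMap_zmod_surjective.comp (chainsEquiv S ℤ n).surjective)
  eq_zero_iff n x := by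
    rw [← (chainsEquiv S (ZMod p) n).map_eq_zero_iff, chainsEquiv_chainsCoeffMap,
      coeffMap_zmod_eq_zero_iff]
    constructor
    · rintro ⟨g, hg⟩
      refine ⟨(chainsEquiv S ℤ n).symm g, (chainsEquiv S ℤ n).injective ?_⟩
      rw [map_nsmul, LinearEquiv.apply_symm_apply, hg]
    · rintro ⟨y, rfl⟩
      exact ⟨chainsEquiv S ℤ n y, (map_nsmul _ _ _).symm⟩
  torsionFree n x hx := by
    refine (chainsEquiv S ℤ n).map_eq_zero_iff.1 ?_
    have h : p • chainsEquiv S ℤ n x = 0 := by rw [← map_nsmul, hx, map_zero]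
    ext y
    have hy := congrArg ULift.down (DFunLike.congr_fun h y)
    simpa [ULift.smul_down, NeZero.ne p] using hy

end SSet

section Singular

variable (X : TopCat.{w})

theorem finrank_singularHomology_rat (n : ℕ) :
    Module.finrank ℚ (singularHomology ℚ X n) = Module.finrank ℤ (singularHomology ℤ X n) :=
  (isRationalization_simplicialChains (TopCat.toSSet.obj X)).finrank_homology n

theorem card_singularHomology_zero (p : ℕ) [NeZero p] :
    Nat.card (singularHomology (ZMod p) X 0) = mulIndex p (singularHomology ℤ X 0) :=
  (isReduction_simplicialChains (TopCat.toSSet.obj X) p).card_homology_of_not_rel (i := 0)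
    (by simp)

theorem card_singularHomology_succ (p : ℕ) [NeZero p] (n : ℕ) :
    Nat.card (singularHomology (ZMod p) X (n + 1)) =
      mulIndex p (singularHomology ℤ X (n + 1)) * torsionCard p (singularHomology ℤ X n) :=
  (isReduction_simplicialChains (TopCat.toSSet.obj X) p).card_homology (i := n + 1) (j := n) rfl

variable {V : Type} [Finite V] (G : Digraph V) (p : ℕ) [Fact p.Prime]

theorem pathEuler_eq_of_space_int
    (hQ : PathEulerDefined ℚ G) (hp : PathEulerDefined (ZMod p) G)
    (h1 : ∀ n : ℕ, Nonempty (pathHomology ℤ G n ≃+ singularHomology ℤ X n))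
    (h2 : ∀ n : ℕ, Nonempty (pathHomology (ZMod p) G n ≃+ singularHomology (ZMod p) X n)) :
    pathEuler ℚ G = pathEuler (ZMod p) G := by
  refine pathEuler_eq_of_card G p hQ hp (fun n ↦ pathHomology ℤ G n)
    (finrank_pathHomology_rat G) ?_ fun n ↦ ?_
  · rw [Nat.card_congr (h2 0).some.toEquiv, mulIndex_congr (h1 0).some,
      card_singularHomology_zero]
  · rw [Nat.card_congr (h2 (n + 1)).some.toEquiv, mulIndex_congr (h1 (n + 1)).some,
      torsionCard_congr (h1 n).some, card_singularHomology_succ]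

theorem pathEuler_eq_of_space_rat
    (hQ : PathEulerDefined ℚ G) (hp : PathEulerDefined (ZMod p) G)
    (hX : ∀ n : ℕ, Module.Finite ℤ (singularHomology ℤ X n))
    (h1 : ∀ n : ℕ, Nonempty (pathHomology ℚ G n ≃ₗ[ℚ] singularHomology ℚ X n))
    (h2 : ∀ n : ℕ, Nonempty (pathHomology (ZMod p) G n ≃ₗ[ZMod p]
      singularHomology (ZMod p) X n)) :
    pathEuler ℚ G = pathEuler (ZMod p) G := by
  refine pathEuler_eq_of_card G p hQ hp (fun n ↦ singularHomology ℤ X n) (fun n ↦ ?_) ?_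
    fun n ↦ ?_
  · rw [(h1 n).some.finrank_eq, finrank_singularHomology_rat]
  · rw [Nat.card_congr (h2 0).some.toEquiv, card_singularHomology_zero]
  · rw [Nat.card_congr (h2 (n + 1)).some.toEquiv, card_singularHomology_succ]

end Singular

section Tor
open Limits

variable (p : ℕ)

/-- The objects of the standard free resolution of `ℤ/p`. -/
def zmodResolutionX : ℕ → ModuleCat.{0} ℤ
  | 0 => ModuleCat.of ℤ ℤ
  | 1 => ModuleCat.of ℤ ℤ
  | _ + 2 => ModuleCat.of ℤ PUnit

/-- The differentials of the standard free resolution of `ℤ/p`. -/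
def zmodResolutionD : (n : ℕ) → (zmodResolutionX (n + 1) ⟶ zmodResolutionX n)
  | 0 => p • 𝟙 (ModuleCat.of ℤ ℤ)
  | _ + 1 => 0

/-- The complex `0 → ℤ → ℤ` given by the multiplication with `p`. -/
def zmodResolutionComplex : ChainComplex (ModuleCat.{0} ℤ) ℕ :=
  ChainComplex.of zmodResolutionX (zmodResolutionD p) fun n ↦ by
    cases n <;> exact zero_comp

theorem zmodResolutionComplex_d (n : ℕ) :
    (zmodResolutionComplex p).d (n + 1) n = zmodResolutionD p n := by
  simp [zmodResolutionComplex]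

instance (n : ℕ) : Projective ((zmodResolutionComplex p).X n) := by
  obtain (_ | _ | n) := n
  · exact inferInstanceAs (Projective (ModuleCat.of ℤ ℤ))
  · exact inferInstanceAs (Projective (ModuleCat.of ℤ ℤ))
  · exact inferInstanceAs (Projective (ModuleCat.of ℤ PUnit))

theorem zmodResolutionComplex_exactAt_succ [NeZero p] (n : ℕ) :
    (zmodResolutionComplex p).ExactAt (n + 1) := by
  rw [HomologicalComplex.exactAt_iff' _ (n + 1 + 1) (n + 1) n (by simp) (by simp)]
  rw [ShortComplex.moduleCat_exact_iff]
  intro x hx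
  refine ⟨0, ?_⟩
  rw [map_zero]
  cases n with
  | zero =>
    change ((zmodResolutionComplex p).d (0 + 1) 0).hom x = 0 at hx
    rw [zmodResolutionComplex_d] at hx
    have h : p • (show ℤ from x) = 0 := hx
    exact ((smul_eq_zero.1 h).resolve_left (NeZero.ne p)).symm
  | succ n => exact Subsingleton.elim (α := PUnit) _ _

/-- The augmentation of the standard free resolution of `ℤ/p`. -/
def zmodResolutionAugmentation : (zmodResolutionComplex p).X 0 ⟶ ModuleCat.of ℤ (ZMod p) :=
  ModuleCat.ofHom (X := ℤ) (LinearMap.toSpanSingleton ℤ (ZMod p) 1)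

theorem zmodResolution_d_augmentation :
    (zmodResolutionComplex p).d 1 0 ≫ zmodResolutionAugmentation p = 0 := by
  rw [zmodResolutionComplex_d p 0]
  refine ModuleCat.hom_ext (LinearMap.ext fun x ↦ ?_)
  change LinearMap.toSpanSingleton ℤ (ZMod p) 1 (p • (show ℤ from x)) = 0
  exact (exact_int_zmod _).2 ⟨(show ℤ from x), natCast_zsmul (show ℤ from x) p⟩

theorem zmodResolution_exact :
    (ShortComplex.mk _ _ (zmodResolution_d_augmentation p)).Exact := by
  rw [ShortComplex.moduleCat_exact_iff]
  intro x hx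
  obtain ⟨y, hy⟩ := (exact_int_zmod (show ℤ from x)).1 hx
  refine ⟨y, ?_⟩
  change ((zmodResolutionComplex p).d (0 + 1) 0).hom y = x
  rw [zmodResolutionComplex_d]
  refine Eq.trans ?_ hy
  change p • y = (p : ℤ) • y
  simp

instance : Epi (zmodResolutionAugmentation p) :=
  (ModuleCat.epi_iff_surjective _).2 toSpanSingleton_zmod_surjective

/-- The standard free resolution of `ℤ/p`. -/
def zmodResolution [NeZero p] : ProjectiveResolution (ModuleCat.of ℤ (ZMod p)) where
  complex := zmodResolutionComplex p
  π := (ChainComplex.toSingle₀Equiv _ _).symm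
    ⟨zmodResolutionAugmentation p, zmodResolution_d_augmentation p⟩
  quasiIso := ⟨fun n ↦ by
    cases n
    · rw [ChainComplex.quasiIsoAt₀_iff, ShortComplex.quasiIso_iff_of_zeros']
      · refine (ShortComplex.exact_and_epi_g_iff_of_iso ?_).2
          ⟨zmodResolution_exact p, by dsimp; infer_instance⟩
        exact ShortComplex.isoMk (Iso.refl _) (Iso.refl _) (Iso.refl _)
          ((Category.id_comp _).trans (Category.comp_id _).symm)
          ((Category.id_comp _).trans (Category.comp_id _).symm)
      all_goals rfl
    · rw [quasiIsoAt_iff_exactAt']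
      · apply zmodResolutionComplex_exactAt_succ
      · apply ChainComplex.exactAt_succ_single_obj⟩

theorem card_tor [NeZero p] (A : ModuleCat.{0} ℤ) :
    Nat.card (tor A (ModuleCat.of ℤ (ZMod p))) = torsionCard p A := by
  let F := (MonoidalCategory.tensoringLeft (ModuleCat.{0} ℤ)).obj A
  let C := (F.mapHomologicalComplex (ComplexShape.down ℕ)).obj (zmodResolution p).complex
  have e1 : tor A (ModuleCat.of ℤ (ZMod p)) ≅ C.homology 1 :=
    (zmodResolution p).isoLeftDerivedObj F 1
  have hd1 : C.d 1 0 = p • 𝟙 (C.X 1) := by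
    change F.map ((zmodResolutionComplex p).d (0 + 1) 0) = _
    rw [zmodResolutionComplex_d]
    change F.map (p • 𝟙 (ModuleCat.of ℤ ℤ)) = _
    rw [Functor.map_nsmul, F.map_id]
    rfl
  have hd2 : C.d 2 1 = 0 := by
    change F.map ((zmodResolutionComplex p).d (1 + 1) 1) = _
    rw [zmodResolutionComplex_d]
    exact F.map_zero _ _
  rw [Nat.card_congr e1.toLinearEquiv.toEquiv,
    Nat.card_congr (homologyAddEquiv C 2 1 0 (by simp) (by simp)).toEquiv, card_kerModRange]
  have hr : (C.d 2 1).hom.toAddMonoidHom.range = ⊥ := by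
    rw [hd2]
    exact AddMonoidHom.range_eq_bot_iff.2 rfl
  have hk : (C.d 1 0).hom.toAddMonoidHom.ker = (nsmulAddMonoidHom p : C.X 1 →+ C.X 1).ker := by
    rw [hd1]
    rfl
  rw [hr, hk, AddSubgroup.relIndex_bot_left]
  exact torsionCard_congr (AddEquiv.mk' (TensorProduct.rid ℤ A).toEquiv
    (TensorProduct.rid ℤ A).map_add)

theorem card_tensor_zmod (A : Type) [AddCommGroup A] {inst : Module ℤ A} :
    Nat.card (TensorProduct ℤ A (ZMod p)) = mulIndex p A := by
  let q : A →+ TensorProduct ℤ (ZMod p) A := (TensorProduct.mk ℤ (ZMod p) A 1).toAddMonoidHom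
  have hq : Function.Surjective q := one_tmul_zmod_surjective
  have hk : (nsmulAddMonoidHom p : A →+ A).range = q.ker := by
    ext x
    exact (one_tmul_zmod_eq_zero_iff x).symm
  rw [Nat.card_congr (TensorProduct.comm ℤ A (ZMod p)).toEquiv, mulIndex, hk,
    AddSubgroup.index_ker, AddMonoidHom.range_eq_top.2 hq, AddSubgroup.card_top]

/-- If the universal coefficient sequences for the path homology are exact, the Euler
characteristics agree. -/
theorem pathEuler_eq_of_exact {V : Type} [Finite V] (G : Digraph V) (p : ℕ) [Fact p.Prime]
    (hQ : PathEulerDefined ℚ G) (hp : PathEulerDefined (ZMod p) G)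
    (h : ∀ n : ℤ, ∃ (f : TensorProduct ℤ (pathHomology ℤ G n) (ZMod p) →+
        pathHomology (ZMod p) G n)
      (g : pathHomology (ZMod p) G n →+
        tor (pathHomology ℤ G (n - 1)) (ModuleCat.of ℤ (ZMod p))),
      Function.Injective f ∧ Function.Exact f g ∧ Function.Surjective g) :
    pathEuler ℚ G = pathEuler (ZMod p) G := by
  have hcard : ∀ n : ℤ, Nat.card (pathHomology (ZMod p) G n) =
      mulIndex p (pathHomology ℤ G n) * torsionCard p (pathHomology ℤ G (n - 1)) := fun n ↦ by
    obtain ⟨f, g, hf, hfg, hg⟩ := h n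
    rw [← card_tor, ← card_tensor_zmod, Nat.card_congr (AddMonoidHom.ofInjective hf).toEquiv,
      ← g.ker.card_mul_index, AddSubgroup.index_ker, AddMonoidHom.range_eq_top.2 hg,
      AddSubgroup.card_top, hfg.addMonoidHom_ker_eq]
  refine pathEuler_eq_of_card G p hQ hp (fun n ↦ pathHomology ℤ G n)
    (finrank_pathHomology_rat G) ?_ fun n ↦ ?_
  · have h0 := hcard 0
    have h1 : torsionCard p (pathHomology ℤ G (0 - 1)) = 1 :=
      torsionCard_of_torsionFree PUnit fun _ _ ↦ rfl
    rw [h1, mul_one] at h0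
    exact h0
  · have h1 := hcard (n + 1 : ℕ)
    have h2 : ((n + 1 : ℕ) : ℤ) - 1 = n := by push_cast; ring
    rw [h2] at h1
    exact h1

end Tor

section EulerOfChains

variable {V : Type u} [Finite V] (G : Digraph V) (F : Type v) [Field F]

theorem finrank_pathHomology_zero :
    Module.finrank F (pathChains F G 0) = Module.finrank F (pathHomology F G (0 : ℕ)) +
      Module.finrank F (LinearMap.range (pathBoundary F G 0)) := by
  have e := homologyEquiv (pathComplex F G) 1 0 0 (by simp) (by simp)
  have h0 : (pathComplex F G).d 0 0 = 0 := HomologicalComplex.shape _ _ _ (by simp)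
  have h1 : (pathComplex F G).d 1 0 = ModuleCat.ofHom (pathBoundary F G 0) := pathComplex_d F G 0
  rw [h0, h1] at e
  have h2 := e.finrank_eq
  have h3 := Submodule.finrank_quotient_add_finrank (R := F)
    (M := LinearMap.ker (0 : pathChains F G 0 →ₗ[F] pathChains F G 0))
    ((LinearMap.range (pathBoundary F G 0)).submoduleOf
      (LinearMap.ker (0 : pathChains F G 0 →ₗ[F] pathChains F G 0)))
  have h4 : Module.finrank F (LinearMap.ker (0 : pathChains F G 0 →ₗ[F] pathChains F G 0)) =
      Module.finrank F (pathChains F G 0) := by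
    rw [LinearMap.ker_zero, finrank_top]
  have h5 : Module.finrank F ((LinearMap.range (pathBoundary F G 0)).submoduleOf
      (LinearMap.ker (0 : pathChains F G 0 →ₗ[F] pathChains F G 0))) =
      Module.finrank F (LinearMap.range (pathBoundary F G 0)) :=
    (Submodule.submoduleOfEquivOfLe (by rw [LinearMap.ker_zero]; exact le_top)).finrank_eq
  rw [← h4, ← h3, h5]
  exact congrArg (· + _) h2.symm

theorem finrank_pathHomology_succ (n : ℕ) :
    Module.finrank F (pathChains F G (n + 1)) =
      Module.finrank F (pathHomology F G (n + 1 : ℕ)) +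
      Module.finrank F (LinearMap.range (pathBoundary F G (n + 1))) +
      Module.finrank F (LinearMap.range (pathBoundary F G n)) := by
  have e := homologyEquiv (pathComplex F G) (n + 2) (n + 1) n (by simp) (by simp)
  rw [pathComplex_d, pathComplex_d] at e
  have h2 := e.finrank_eq
  have h3 := Submodule.finrank_quotient_add_finrank (R := F)
    (M := LinearMap.ker (pathBoundary F G n))
    ((LinearMap.range (pathBoundary F G (n + 1))).submoduleOf
      (LinearMap.ker (pathBoundary F G n)))
  have h4 := LinearMap.finrank_range_add_finrank_ker (pathBoundary F G n)
  have h5 : Module.finrank F ((LinearMap.range (pathBoundary F G (n + 1))).submoduleOf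
      (LinearMap.ker (pathBoundary F G n))) =
      Module.finrank F (LinearMap.range (pathBoundary F G (n + 1))) :=
    (Submodule.submoduleOfEquivOfLe
      (LinearMap.range_le_ker_iff.2 (pathBoundary_comp F G n))).finrank_eq
  rw [← h4, ← h3, h5, add_comm]
  exact congrArg (· + _ + _) h2.symm

theorem pathEulerDefined_of_chains {N : ℕ} (h : ∀ n, N ≤ n → pathChains F G n = ⊥) :
    PathEulerDefined F G := by
  refine (Set.finite_Ico (0 : ℤ) N).subset fun n hn ↦ ?_
  by_contra h0
  refine hn ?_
  cases n with
  | ofNat n =>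
    have hN : N ≤ n := by
      by_contra hlt
      exact h0 ⟨Int.natCast_nonneg n, Int.ofNat_lt.2 (not_le.1 hlt)⟩
    have : Module.finrank F (pathHomology F G n) = 0 := by
      cases n with
      | zero =>
        have h1 := finrank_pathHomology_zero G F
        have h2 := (congrArg (fun W : Submodule F _ ↦ Module.finrank F W) (h _ hN)).trans
          (finrank_bot F _)
        omega
      | succ n =>
        have h1 := finrank_pathHomology_succ G F n
        have h2 := (congrArg (fun W : Submodule F _ ↦ Module.finrank F W) (h _ hN)).trans
          (finrank_bot F _)
        omega
    exact Module.finrank_zero_iff.1 this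
  | negSucc n => exact inferInstanceAs (Subsingleton PUnit)

/-- The path Euler characteristic in terms of the path chains. -/
theorem pathEuler_eq_sum {N : ℕ} (h : ∀ n, N ≤ n → pathChains F G n = ⊥) :
    pathEuler F G =
      ∑ n ∈ Finset.range N, (-1 : ℤ) ^ n * (Module.finrank F (pathChains F G n) : ℤ) := by
  obtain ⟨M, hM⟩ := exists_finrank_eq_zero G (pathEulerDefined_of_chains G F h)
  have h1 := finsum_alternating_eq (fun n ↦ Module.finrank F (pathHomology F G n))
    (fun n ↦ Module.finrank F (pathChains F G n))
    (fun n ↦ Module.finrank F (LinearMap.range (pathBoundary F G n)))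
    (finrank_pathHomology_zero G F) (finrank_pathHomology_succ G F) (max M N)
    (fun n hn ↦ hM n (le_trans (le_max_left _ _) hn))
    (fun n hn ↦ by rw [h n (le_trans (le_max_right _ _) hn), finrank_bot])
  refine h1.trans (finsum_eq_sum_of_support_subset _ fun n hn ↦ ?_)
  by_contra hlt
  refine hn ?_
  simp only [Finset.coe_range, Set.mem_Iio, not_lt] at hlt
  simp [h n hlt]

end EulerOfChains

section Coefficients

variable {K : Type v} [CommRing K] {V : Type u}

/-- The sequences without consecutive repetitions. -/
def IsRegular {n : ℕ} (x : Fin (n + 1) → V) : Prop := ∀ i : Fin n, x i.castSucc ≠ x i.succ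

/-- The sequences of vertices in which consecutive entries are joined by an arrow. -/
def IsPath (G : Digraph V) {n : ℕ} (x : Fin (n + 1) → V) : Prop :=
  ∀ i : Fin n, G.Adj (x i.castSucc) (x i.succ)

variable (K) in
/-- The coefficient of a regular chain at a sequence without consecutive repetitions. -/
def regularCoeff {n : ℕ} (x : Fin (n + 1) → V) (hx : IsRegular x) : Regular K V n →ₗ[K] K :=
  (degenerate K V n).liftQ (Finsupp.lapply x) (Submodule.span_le.2 (by
    rintro _ ⟨y, ⟨i, hi⟩, rfl⟩
    have : y ≠ x := by
      rintro rfl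
      exact hx i hi
    simp [tuple, this]))

theorem regularCoeff_mkQ {n : ℕ} (x : Fin (n + 1) → V) (hx : IsRegular x) (t : Tuples K V n) :
    regularCoeff K x hx ((degenerate K V n).mkQ t) = t x := rfl

theorem mem_allowed_iff (G : Digraph V) {n : ℕ} (x : Regular K V n) :
    x ∈ allowed K G n ↔ ∀ y (hy : IsRegular y), ¬ IsPath G y → regularCoeff K y hy x = 0 := by
  constructor
  · intro hx y hy hyG
    revert hx
    suffices allowed K G n ≤ LinearMap.ker (regularCoeff K y hy) from fun hx ↦ this hx
    refine Submodule.span_le.2 ?_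
    rintro _ ⟨z, hz, rfl⟩
    have : z ≠ y := by
      rintro rfl
      exact hyG hz
    simp only [SetLike.mem_coe, LinearMap.mem_ker, regularCoeff_mkQ]
    simp [tuple, this]
  · intro h
    obtain ⟨t, rfl⟩ := Submodule.mkQ_surjective _ x
    have ht : t = t.sum fun y a ↦ a • tuple K y := by
      conv_lhs => rw [← t.sum_single]
      simp [tuple]
    rw [ht, Finsupp.sum, map_sum]
    refine Submodule.sum_mem _ fun y _ ↦ ?_
    rw [map_smul]
    by_cases hyG : IsPath G y
    · exact Submodule.smul_mem _ _ (Submodule.subset_span ⟨y, hyG, rfl⟩)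
    · by_cases hy : IsRegular y
      · have := h y hy hyG
        rw [regularCoeff_mkQ] at this
        rw [this, zero_smul]
        exact zero_mem _
      · have h0 : (degenerate K V n).mkQ (tuple K y) = 0 :=
          (Submodule.Quotient.mk_eq_zero _).2 (Submodule.subset_span
            ⟨y, by simpa [IsRegular] using hy, rfl⟩)
        rw [h0, smul_zero]
        exact zero_mem _

/-- The coefficient of `y` in the boundary of `x`. -/
def faceCoeff [DecidableEq V] {n : ℕ} (x : Fin (n + 2) → V) (y : Fin (n + 1) → V) : ℤ :=
  ∑ j : Fin (n + 2), if (fun l ↦ x (j.succAbove l)) = y then (-1) ^ (j : ℕ) else 0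

theorem regularCoeff_boundary [DecidableEq V] {n : ℕ} (x : Fin (n + 2) → V) (y : Fin (n + 1) → V)
    (hy : IsRegular y) :
    regularCoeff K y hy (regularBoundary K V n ((degenerate K V (n + 1)).mkQ (tuple K x))) =
      (faceCoeff x y : K) := by
  change regularCoeff K y hy ((degenerate K V n).mkQ (tuplesBoundary K V n (tuple K x))) = _
  rw [regularCoeff_mkQ, tuplesBoundary_tuple, faceCoeff, Finsupp.finsetSum_apply, Int.cast_sum]
  refine Finset.sum_congr rfl fun j _ ↦ ?_
  by_cases h : (fun l ↦ x (j.succAbove l)) = y <;> simp [tuple, h]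

end Coefficients

section Relations

variable {V : Type u} {ι κ : Type*} [Fintype ι]

/-- The module spanned by a family of sequences, as a map from its coefficients. -/
def chainOf (K : Type v) [CommRing K] {n : ℕ} (P : ι → Fin (n + 1) → V) :
    (ι → K) →ₗ[K] Regular K V n :=
  Fintype.linearCombination K fun i ↦ (degenerate K V n).mkQ (tuple K (P i))

theorem regularCoeff_chainOf (K : Type v) [CommRing K] {n : ℕ} {P : ι → Fin (n + 1) → V}
    (hP : Function.Injective P) (i : ι) (hi : IsRegular (P i)) (f : ι → K) :
    regularCoeff K (P i) hi (chainOf K P f) = f i := by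
  classical
  rw [chainOf, Fintype.linearCombination_apply, map_sum, Finset.sum_eq_single i]
  · rw [map_smul, regularCoeff_mkQ]
    simp [tuple]
  · intro j _ hj
    rw [map_smul, regularCoeff_mkQ]
    simp [tuple, hP.ne hj]
  · simp

theorem chainOf_injective (K : Type v) [CommRing K] {n : ℕ} {P : ι → Fin (n + 1) → V}
    (hP : Function.Injective P) (hreg : ∀ i, IsRegular (P i)) :
    Function.Injective (chainOf K P) := fun f g h ↦ by
  ext i
  rw [← regularCoeff_chainOf K hP i (hreg i) f, h, regularCoeff_chainOf K hP]

theorem range_chainOf (K : Type v) [CommRing K] (G : Digraph V) {n : ℕ}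
    {P : ι → Fin (n + 1) → V} (hP : ∀ x, IsPath G x ↔ ∃ i, P i = x) :
    LinearMap.range (chainOf K P) = allowed K G n := by
  rw [chainOf, Fintype.range_linearCombination, allowed]
  congr 1
  ext e
  constructor
  · rintro ⟨i, rfl⟩
    exact ⟨P i, (hP _).2 ⟨i, rfl⟩, rfl⟩
  · rintro ⟨x, hx, rfl⟩
    obtain ⟨i, rfl⟩ := (hP x).1 hx
    exact ⟨i, rfl⟩

theorem isRegular_of_isPath {G : Digraph V} (hG : ∀ v, ¬ G.Adj v v) {n : ℕ}
    {x : Fin (n + 1) → V} (hx : IsPath G x) : IsRegular x := fun i h ↦ hG (x i.succ) (by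
  have := hx i
  rwa [h] at this)

theorem finrank_allowed (F : Type v) [Field F] [Finite V] (G : Digraph V)
    (hG : ∀ v, ¬ G.Adj v v) (n : ℕ) :
    Module.finrank F (allowed F G n) = Nat.card {x : Fin (n + 1) → V // IsPath G x} := by
  classical
  let : Fintype {x : Fin (n + 1) → V // IsPath G x} := Fintype.ofFinite _
  rw [← range_chainOf F G (P := fun x : {x : Fin (n + 1) → V // IsPath G x} ↦ x.1)
    (fun x ↦ by simp), LinearMap.finrank_range_of_inj (chainOf_injective F
      Subtype.val_injective fun x ↦ isRegular_of_isPath hG x.2), Module.finrank_fintype_fun_eq_card,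
    Nat.card_eq_fintype_card]

/-- The linear relations between the coefficients of a combination of sequences which express
that its boundary has no coefficients at the given sequences. -/
def faceRelations [DecidableEq V] (K : Type v) [CommRing K] {n : ℕ} (P : ι → Fin (n + 2) → V)
    (Q : κ → Fin (n + 1) → V) : Submodule K (ι → K) where
  carrier := {f | ∀ k, ∑ i, f i * (faceCoeff (P i) (Q k) : K) = 0}
  zero_mem' := by simp
  add_mem' hf hg k := by
    simp only [Pi.add_apply, add_mul, Finset.sum_add_distrib, hf k, hg k, add_zero]
  smul_mem' a f hf k := by
    simp only [Pi.smul_apply, smul_eq_mul, mul_assoc, ← Finset.mul_sum, hf k, mul_zero]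

/-- The dimension of the path chains, in terms of an enumeration `P` of the paths and an
enumeration `Q` of the faces of the paths that are not paths. -/
theorem finrank_pathChains_succ [DecidableEq V] (F : Type v) [Field F] (G : Digraph V)
    (hG : ∀ v, ¬ G.Adj v v) {n : ℕ} {P : ι → Fin (n + 2) → V} (hPinj : Function.Injective P)
    (hP : ∀ x, IsPath G x ↔ ∃ i, P i = x) {Q : κ → Fin (n + 1) → V}
    (hQ : ∀ k, IsRegular (Q k) ∧ ¬ IsPath G (Q k))
    (hface : ∀ i (j : Fin (n + 2)), IsPath G (fun l ↦ P i (j.succAbove l)) ∨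
      ∃ k, Q k = fun l ↦ P i (j.succAbove l)) :
    Module.finrank F (pathChains F G (n + 1)) = Module.finrank F (faceRelations F P Q) := by
  have hcoeff : ∀ f y (hy : IsRegular y), regularCoeff F y hy
      (regularBoundary F V n (chainOf F P f)) = ∑ i, f i * (faceCoeff (P i) y : F) := by
    intro f y hy
    rw [chainOf, Fintype.linearCombination_apply, map_sum, map_sum]
    refine Finset.sum_congr rfl fun i _ ↦ ?_
    rw [map_smul, map_smul, regularCoeff_boundary, smul_eq_mul]
  have hmem : ∀ f, f ∈ faceRelations F P Q ↔
      regularBoundary F V n (chainOf F P f) ∈ allowed F G n := by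
    intro f
    rw [mem_allowed_iff]
    constructor
    · intro hf y hy hyG
      rw [hcoeff]
      by_cases hk : ∃ k, Q k = y
      · obtain ⟨k, rfl⟩ := hk
        exact hf k
      · refine Finset.sum_eq_zero fun i _ ↦ ?_
        have : faceCoeff (P i) y = 0 := Finset.sum_eq_zero fun j _ ↦ if_neg fun h ↦ by
          rcases hface i j with h' | h'
          · rw [h] at h'
            exact hyG h'
          · rw [h] at h'
            exact hk h'
        rw [this, Int.cast_zero, mul_zero]
    · intro h k
      rw [← hcoeff f (Q k) (hQ k).1]
      exact h _ _ (hQ k).2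
  have hmap : pathChains F G (n + 1) = (faceRelations F P Q).map (chainOf F P) := by
    ext x
    constructor
    · rintro ⟨hx, hx'⟩
      rw [SetLike.mem_coe, ← range_chainOf F G hP] at hx
      obtain ⟨f, rfl⟩ := hx
      exact ⟨f, (hmem f).2 hx', rfl⟩
    · rintro ⟨f, hf, rfl⟩
      refine ⟨?_, (hmem f).1 hf⟩
      rw [SetLike.mem_coe, ← range_chainOf F G hP]
      exact ⟨f, rfl⟩
  rw [hmap]
  exact (Submodule.equivMapOfInjective _
    (chainOf_injective F hPinj fun i ↦ isRegular_of_isPath hG ((hP _).2 ⟨i, rfl⟩)) _).finrank_eq.symm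

end Relations

section Forest

variable {ι κ : Type} (F : Type v) [Field F]

/-- The functions whose values at the two ends of every edge of a graph are opposite. -/
def oppositeFunctions (a b : κ → ι) : Submodule F (ι → F) where
  carrier := {f | ∀ k, f (a k) + f (b k) = 0}
  zero_mem' := by simp
  add_mem' {f g} hf hg k := by
    have h := congrArg₂ (· + ·) (hf k) (hg k)
    simp only [add_zero] at h
    rw [← h, Pi.add_apply, Pi.add_apply]
    ring
  smul_mem' c f hf k := by
    simp only [Pi.smul_apply, smul_eq_mul, ← mul_add, hf k, mul_zero]

theorem faceRelations_eq_oppositeFunctions [Fintype ι] [DecidableEq ι] {V : Type u} [DecidableEq V]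
    {n : ℕ} {P : ι → Fin (n + 2) → V} {Q : κ → Fin (n + 1) → V} {a b : κ → ι} (s : κ → ℤˣ)
    (h : ∀ k i, faceCoeff (P i) (Q k) = s k * ((if i = a k then 1 else 0) + if i = b k then 1 else 0)) :
    faceRelations F P Q = oppositeFunctions F a b := by
  ext f
  refine forall_congr' fun k ↦ ?_
  have h1 : ∑ i, f i * (faceCoeff (P i) (Q k) : F) = ((s k : ℤ) : F) * (f (a k) + f (b k)) := by
    simp only [h, Int.cast_mul, Int.cast_add, Int.cast_ite, Int.cast_one, Int.cast_zero]
    simp only [mul_add, Finset.sum_add_distrib, mul_ite, mul_one, mul_zero, Finset.sum_ite_eq',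
      Finset.mem_univ, if_true]
    ring
  have h2 : ((s k : ℤ) : F) ≠ 0 := by
    rcases Int.units_eq_one_or (s k) with h | h <;> simp [h]
  rw [h1, mul_eq_zero, or_iff_right h2]

/-- The dimension of the space of opposite functions on a bipartite graph with a rooted spanning
forest. -/
theorem finrank_oppositeFunctions [Fintype ι] [DecidableEq ι] {a b : κ → ι} (next : ι → ι) (d : ι → ℕ)
    (hd : ∀ x, d x = 0 ∨ (d (next x) + 1 = d x ∧
      ∃ k, (a k = x ∧ b k = next x) ∨ (b k = x ∧ a k = next x)))
    (hroot : ∀ k, next^[d (a k)] (a k) = next^[d (b k)] (b k))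
    (hodd : ∀ k, (d (a k) + d (b k)) % 2 = 1) :
    Module.finrank F (oppositeFunctions F a b) = Fintype.card {x // d x = 0} := by
  have hroot0 : ∀ m x, d x = m → d (next^[m] x) = 0 := by
    intro m
    induction m with
    | zero => exact fun x hx ↦ hx
    | succ m ih =>
      intro x hx
      rw [Function.iterate_succ_apply]
      refine ih _ ?_
      rcases hd x with h | h <;> omega
  have hval : ∀ f ∈ oppositeFunctions F a b, ∀ m x, d x = m →
      f x = (-1) ^ m * f (next^[m] x) := by
    intro f hf m
    induction m with
    | zero => simp
    | succ m ih =>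
      intro x hx
      rcases hd x with h | ⟨h, k, hk⟩
      · omega
      · have h1 : f x + f (next x) = 0 := by
          rcases hk with ⟨h1, h2⟩ | ⟨h1, h2⟩
          · have := hf k
            rwa [h1, h2] at this
          · have := hf k
            rwa [h1, h2, add_comm] at this
        rw [Function.iterate_succ_apply, pow_succ, mul_neg_one, neg_mul, ← ih (next x) (by omega)]
        exact eq_neg_of_add_eq_zero_left h1
  let e : oppositeFunctions F a b →ₗ[F] ({x // d x = 0} → F) :=
    { toFun f x := f.1 x.1
      map_add' _ _ := rfl
      map_smul' _ _ := rfl }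
  have he : Function.Bijective e := by
    constructor
    · intro f g hfg
      refine Subtype.ext (funext fun x ↦ ?_)
      rw [hval f.1 f.2 _ x rfl, hval g.1 g.2 _ x rfl]
      exact congrArg _ (congrFun hfg ⟨next^[d x] x, hroot0 _ x rfl⟩)
    · intro g
      refine ⟨⟨fun x ↦ (-1) ^ d x * g ⟨next^[d x] x, hroot0 _ x rfl⟩, fun k ↦ ?_⟩, ?_⟩
      · have h1 : (⟨next^[d (a k)] (a k), hroot0 _ _ rfl⟩ : {x // d x = 0}) =
            ⟨next^[d (b k)] (b k), hroot0 _ _ rfl⟩ := Subtype.ext (hroot k)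
        have h2 : (-1 : F) ^ d (a k) = -(-1) ^ d (b k) := by
          have h3 := hodd k
          rcases Nat.even_or_odd (d (a k)) with h | h <;>
            rcases Nat.even_or_odd (d (b k)) with h' | h' <;>
            simp only [h.neg_one_pow, h'.neg_one_pow, neg_neg] <;>
            simp only [Nat.even_iff, Nat.odd_iff] at h h' <;> omega
        dsimp only
        rw [h1, h2, neg_mul, neg_add_cancel]
      · funext x
        change (-1) ^ d x.1 * g _ = g x
        have hx : (⟨next^[d x.1] x.1, hroot0 _ x.1 rfl⟩ : {x // d x = 0}) = x :=
          Subtype.ext ((congrArg (fun m ↦ next^[m] x.1) x.2).trans rfl)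
        rw [hx, x.2, pow_zero, one_mul]
  rw [(LinearEquiv.ofBijective e he).finrank_eq, Module.finrank_fintype_fun_eq_card]

end Forest

section Example
open ExampleVertex

/-- A numbering of the vertices of the example. -/
def ExampleVertex.code : ExampleVertex → ℕ
  | x0 => 0
  | x1 i => 1 + ZMod.val i
  | x2 i => 4 + ZMod.val i
  | x3 i => 7 + ZMod.val i
  | x4 => 10

theorem ExampleVertex.code_injective : Function.Injective ExampleVertex.code := by
  have h : ∀ i : ZMod 3, ZMod.val i < 3 := fun i ↦ ZMod.val_lt i
  rintro (_ | i | i | i | _) (_ | j | j | j | _) hij <;> simp only [code] at hij <;>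
    first
    | rfl
    | exact congrArg _ (ZMod.val_injective 3 (by omega))
    | (have := h i; have := h j; omega)
    | (have := h i; omega)
    | (have := h j; omega)
    | omega

instance : DecidableEq ExampleVertex := ExampleVertex.code_injective.decidableEq

instance : Fintype ExampleVertex where
  elems := {x0, x1 0, x1 1, x1 2, x2 0, x2 1, x2 2, x3 0, x3 1, x3 2, x4}
  complete := by
    have h : ∀ i : ZMod 3, i = 0 ∨ i = 1 ∨ i = 2 := by decide
    rintro (_ | i | i | i | _) <;> first | decide | rcases h i with rfl | rfl | rfl <;> decide

instance : DecidableRel exampleDigraph.Adj := fun a b ↦ by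
  rcases a with _ | i | i | i | _ <;> rcases b with _ | j | j | j | _ <;>
    first
    | exact isTrue trivial
    | exact isFalse id
    | exact decidable_of_iff (j = i ∨ j = i + 1) Iff.rfl
    | exact decidable_of_iff (j = i ∨ j = i + 2) Iff.rfl

instance {n : ℕ} : DecidablePred (IsPath exampleDigraph (n := n)) := fun _ ↦
  inferInstanceAs (Decidable (∀ _, _))

theorem exampleDigraph_irrefl : ∀ v, ¬ exampleDigraph.Adj v v := by decide

/-- The `2`-paths of the example. -/
def twoPaths : Fin 12 × ZMod 3 → Fin 3 → ExampleVertex := fun ⟨t, i⟩ ↦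
  ![![x0, x1 i, x2 i], ![x0, x1 i, x2 (i + 1)], ![x0, x1 i, x3 i], ![x0, x1 i, x3 (i + 2)],
    ![x1 i, x2 i, x3 i], ![x1 i, x2 i, x3 (i + 1)], ![x1 i, x2 (i + 1), x3 (i + 1)],
    ![x1 i, x2 (i + 1), x3 (i + 2)], ![x1 i, x3 i, x4], ![x1 i, x3 (i + 2), x4],
    ![x2 i, x3 i, x4], ![x2 i, x3 (i + 1), x4]] t

/-- The faces of `2`-paths of the example that are not paths. -/
def twoFaces : Fin 5 × ZMod 3 → Fin 2 → ExampleVertex := fun ⟨t, i⟩ ↦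
  ![![x0, x2 i], ![x0, x3 i], ![x1 i, x3 (i + 1)], ![x1 i, x4], ![x2 i, x4]] t

/-- One of the paths that have a given face. -/
def twoFacesLeft : Fin 5 × ZMod 3 → Fin 12 × ZMod 3 := fun ⟨t, i⟩ ↦
  (![0, 2, 5, 8, 10] t, i)

/-- The other path that has a given face. -/
def twoFacesRight : Fin 5 × ZMod 3 → Fin 12 × ZMod 3 := fun ⟨t, i⟩ ↦
  ![(1, i + 2), (3, i + 1), (6, i), (9, i), (11, i)] t

theorem twoPaths_injective : Function.Injective twoPaths := by
  unfold Function.Injective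
  decide +kernel

theorem isPath_iff_two : ∀ x, IsPath exampleDigraph x ↔ ∃ i, twoPaths i = x := by
  have h : ∀ a b, exampleDigraph.Adj a b → ∀ c, exampleDigraph.Adj b c →
      ∃ i, twoPaths i = ![a, b, c] := by decide +kernel
  have h' : ∀ i, IsPath exampleDigraph (twoPaths i) := by decide +kernel
  refine fun x ↦ ⟨fun hx ↦ ?_, ?_⟩
  · obtain ⟨i, hi⟩ := h _ _ (hx 0) _ (hx 1)
    exact ⟨i, hi.trans (by ext j; fin_cases j <;> rfl)⟩
  · rintro ⟨i, rfl⟩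
    exact h' i

theorem coeff_two : ∀ k i, faceCoeff (twoPaths i) (twoFaces k) = ((-1 : ℤˣ) : ℤ) *
    ((if i = twoFacesLeft k then 1 else 0) + if i = twoFacesRight k then 1 else 0) := by
  decide +kernel

theorem nonpath_two : ∀ k, IsRegular (twoFaces k) ∧ ¬ IsPath exampleDigraph (twoFaces k) := by
  unfold IsRegular
  decide +kernel

theorem face_two : ∀ i (j : Fin 3), IsPath exampleDigraph (fun l ↦ twoPaths i (j.succAbove l)) ∨
    ∃ k, twoFaces k = fun l ↦ twoPaths i (j.succAbove l) := by
  decide +kernel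

/-- The parents in a rooted forest on the `2`-paths. -/
def twoNext : Fin 12 × ZMod 3 → Fin 12 × ZMod 3 := fun ⟨t, i⟩ ↦
  ![(0, i), (0, i + 1), (2, i), (2, i + 2), (4, i), (5, i), (5, i), (7, i), (8, i), (8, i),
    (10, i), (10, i)] t

/-- The depths in a rooted forest on the `2`-paths. -/
def twoDepth : Fin 12 × ZMod 3 → ℕ := fun ⟨t, _⟩ ↦ ![0, 1, 0, 1, 0, 0, 1, 0, 0, 1, 0, 1] t

theorem finrank_pathChains_two (F : Type v) [Field F] :
    Module.finrank F (pathChains F exampleDigraph 2) = 21 := by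
  rw [finrank_pathChains_succ F exampleDigraph exampleDigraph_irrefl twoPaths_injective
    isPath_iff_two nonpath_two face_two,
    faceRelations_eq_oppositeFunctions F (fun _ ↦ -1) coeff_two,
    finrank_oppositeFunctions F twoNext twoDepth (by decide +kernel) (by decide +kernel)
      (by decide +kernel)]
  decide +kernel

/-- The `3`-paths of the example. -/
def threePaths : Fin 10 × ZMod 3 → Fin 4 → ExampleVertex := fun ⟨t, i⟩ ↦
  ![![x0, x1 i, x2 i, x3 i], ![x0, x1 i, x2 i, x3 (i + 1)],
    ![x0, x1 i, x2 (i + 1), x3 (i + 1)], ![x0, x1 i, x2 (i + 1), x3 (i + 2)],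
    ![x0, x1 i, x3 i, x4], ![x0, x1 i, x3 (i + 2), x4],
    ![x1 i, x2 i, x3 i, x4], ![x1 i, x2 i, x3 (i + 1), x4],
    ![x1 i, x2 (i + 1), x3 (i + 1), x4], ![x1 i, x2 (i + 1), x3 (i + 2), x4]] t

/-- The faces of `3`-paths of the example that are not paths. -/
def threeFaces : Fin 8 × ZMod 3 → Fin 3 → ExampleVertex := fun ⟨t, i⟩ ↦
  ![![x0, x2 i, x3 i], ![x0, x2 i, x3 (i + 1)], ![x0, x1 i, x3 (i + 1)], ![x0, x3 i, x4],
    ![x0, x1 i, x4], ![x1 i, x2 i, x4], ![x1 i, x2 (i + 1), x4], ![x1 i, x3 (i + 1), x4]] t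

/-- One of the paths that have a given face. -/
def threeFacesLeft : Fin 8 × ZMod 3 → Fin 10 × ZMod 3 := fun ⟨t, i⟩ ↦
  (![0, 1, 1, 4, 4, 6, 8, 7] t, i)

/-- The other path that has a given face. -/
def threeFacesRight : Fin 8 × ZMod 3 → Fin 10 × ZMod 3 := fun ⟨t, i⟩ ↦
  ![(2, i + 2), (3, i + 2), (2, i), (5, i + 1), (5, i), (7, i), (9, i), (8, i)] t

theorem threePaths_injective : Function.Injective threePaths := by
  unfold Function.Injective
  decide +kernel

theorem isPath_iff_three : ∀ x, IsPath exampleDigraph x ↔ ∃ i, threePaths i = x := by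
  have h : ∀ a b, exampleDigraph.Adj a b → ∀ c, exampleDigraph.Adj b c →
      ∀ d, exampleDigraph.Adj c d → ∃ i, threePaths i = ![a, b, c, d] := by decide +kernel
  have h' : ∀ i, IsPath exampleDigraph (threePaths i) := by decide +kernel
  refine fun x ↦ ⟨fun hx ↦ ?_, ?_⟩
  · obtain ⟨i, hi⟩ := h _ _ (hx 0) _ (hx 1) _ (hx 2)
    exact ⟨i, hi.trans (by ext j; fin_cases j <;> rfl)⟩
  · rintro ⟨i, rfl⟩
    exact h' i

theorem coeff_three : ∀ k i, faceCoeff (threePaths i) (threeFaces k) =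
    ((![-1, -1, 1, -1, 1, 1, 1, -1] k.1 : ℤˣ) : ℤ) *
    ((if i = threeFacesLeft k then 1 else 0) + if i = threeFacesRight k then 1 else 0) := by
  decide +kernel

theorem nonpath_three :
    ∀ k, IsRegular (threeFaces k) ∧ ¬ IsPath exampleDigraph (threeFaces k) := by
  unfold IsRegular
  decide +kernel

theorem face_three : ∀ i (j : Fin 4),
    IsPath exampleDigraph (fun l ↦ threePaths i (j.succAbove l)) ∨
    ∃ k, threeFaces k = fun l ↦ threePaths i (j.succAbove l) := by
  decide +kernel

/-- The parents in a rooted forest on the `3`-paths. -/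
def threeNext : Fin 10 × ZMod 3 → Fin 10 × ZMod 3 := fun ⟨t, i⟩ ↦
  ![(0, i), (2, i), (0, i + 1), (1, i + 1), if i = 1 then (5, 1) else (5, 0),
    if i = 2 then (4, 2) else (4, 0), (6, i), (6, i), (7, i), (8, i)] t

/-- The depths in a rooted forest on the `3`-paths. -/
def threeDepth : Fin 10 × ZMod 3 → ℕ := fun ⟨t, i⟩ ↦
  ![0, 2, 1, 3, if i = 0 then 0 else 2, if i = 2 then 3 else 1, 0, 1, 2, 3] t

theorem finrank_pathChains_three (F : Type v) [Field F] :
    Module.finrank F (pathChains F exampleDigraph 3) = 7 := by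
  rw [finrank_pathChains_succ F exampleDigraph exampleDigraph_irrefl threePaths_injective
    isPath_iff_three nonpath_three face_three,
    faceRelations_eq_oppositeFunctions F _ coeff_three,
    finrank_oppositeFunctions F threeNext threeDepth (by decide +kernel) (by decide +kernel)
      (by decide +kernel)]
  decide +kernel

/-- The `4`-paths of the example. -/
def fourPaths : Fin 4 × ZMod 3 → Fin 5 → ExampleVertex := fun ⟨t, i⟩ ↦
  ![![x0, x1 i, x2 i, x3 i, x4], ![x0, x1 i, x2 i, x3 (i + 1), x4],
    ![x0, x1 i, x2 (i + 1), x3 (i + 1), x4], ![x0, x1 i, x2 (i + 1), x3 (i + 2), x4]] t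

/-- The faces of `4`-paths of the example that are not paths. -/
def fourFaces : Fin 5 × ZMod 3 → Fin 4 → ExampleVertex := fun ⟨t, i⟩ ↦
  ![![x0, x2 i, x3 i, x4], ![x0, x2 i, x3 (i + 1), x4], ![x0, x1 i, x3 (i + 1), x4],
    ![x0, x1 i, x2 i, x4], ![x0, x1 i, x2 (i + 1), x4]] t

/-- One of the paths that have a given face. -/
def fourFacesLeft : Fin 5 × ZMod 3 → Fin 4 × ZMod 3 := fun ⟨t, i⟩ ↦ (![0, 1, 1, 0, 2] t, i)

/-- The other path that has a given face. -/
def fourFacesRight : Fin 5 × ZMod 3 → Fin 4 × ZMod 3 := fun ⟨t, i⟩ ↦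
  ![(2, i + 2), (3, i + 2), (2, i), (1, i), (3, i)] t

theorem fourPaths_injective : Function.Injective fourPaths := by
  unfold Function.Injective
  decide +kernel

theorem isPath_iff_four : ∀ x, IsPath exampleDigraph x ↔ ∃ i, fourPaths i = x := by
  have h : ∀ a b, exampleDigraph.Adj a b → ∀ c, exampleDigraph.Adj b c →
      ∀ d, exampleDigraph.Adj c d → ∀ e, exampleDigraph.Adj d e →
      ∃ i, fourPaths i = ![a, b, c, d, e] := by decide +kernel
  have h' : ∀ i, IsPath exampleDigraph (fourPaths i) := by decide +kernel
  refine fun x ↦ ⟨fun hx ↦ ?_, ?_⟩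
  · obtain ⟨i, hi⟩ := h _ _ (hx 0) _ (hx 1) _ (hx 2) _ (hx 3)
    exact ⟨i, hi.trans (by ext j; fin_cases j <;> rfl)⟩
  · rintro ⟨i, rfl⟩
    exact h' i

theorem coeff_four : ∀ k i, faceCoeff (fourPaths i) (fourFaces k) =
    ((![-1, -1, 1, -1, -1] k.1 : ℤˣ) : ℤ) *
    ((if i = fourFacesLeft k then 1 else 0) + if i = fourFacesRight k then 1 else 0) := by
  decide +kernel

theorem nonpath_four : ∀ k, IsRegular (fourFaces k) ∧ ¬ IsPath exampleDigraph (fourFaces k) := by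
  unfold IsRegular
  decide +kernel

theorem face_four : ∀ i (j : Fin 5),
    IsPath exampleDigraph (fun l ↦ fourPaths i (j.succAbove l)) ∨
    ∃ k, fourFaces k = fun l ↦ fourPaths i (j.succAbove l) := by
  decide +kernel

theorem finrank_pathChains_four (F : Type v) [Field F] :
    Module.finrank F (pathChains F exampleDigraph 4) =
      Module.finrank F (oppositeFunctions F fourFacesLeft fourFacesRight) := by
  rw [finrank_pathChains_succ F exampleDigraph exampleDigraph_irrefl fourPaths_injective
    isPath_iff_four nonpath_four face_four,
    faceRelations_eq_oppositeFunctions F _ coeff_four]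

theorem finrank_pathChains_four_rat :
    Module.finrank ℚ (pathChains ℚ exampleDigraph 4) = 0 := by
  rw [finrank_pathChains_four, Submodule.finrank_eq_zero, Submodule.eq_bot_iff]
  intro f hf
  have h : ∀ t i, f (fourFacesLeft (t, i)) + f (fourFacesRight (t, i)) = 0 := fun t i ↦ hf (t, i)
  have h0 : ∀ i, f (0, i) + f (2, i + 2) = 0 := h 0
  have h1 : ∀ i, f (1, i) + f (2, i) = 0 := h 2
  have h2 : ∀ i, f (0, i) + f (1, i) = 0 := h 3
  have h3 : ∀ i, f (2, i) + f (3, i) = 0 := h 4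
  have hstep : ∀ i, f (0, i + 2) = -f (0, i) := fun i ↦ by
    linarith [h0 i, h1 (i + 2), h2 (i + 2)]
  have hthree : ∀ i : ZMod 3, i + 2 + 2 + 2 = i := by decide
  have hzero : ∀ i, f (0, i) = 0 := fun i ↦ by
    have h4 := hstep (i + 2 + 2)
    rw [hthree, hstep, hstep] at h4
    linarith
  funext ⟨t, i⟩
  fin_cases t
  · exact hzero i
  · exact (by linarith [hzero i, h2 i] : f (1, i) = 0)
  · exact (by linarith [hzero i, h2 i, h1 i] : f (2, i) = 0)
  · exact (by linarith [hzero i, h2 i, h1 i, h3 i] : f (3, i) = 0)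

theorem finrank_pathChains_four_two :
    Module.finrank (ZMod 2) (pathChains (ZMod 2) exampleDigraph 4) ≠ 0 := by
  rw [finrank_pathChains_four, Ne, Submodule.finrank_eq_zero, Submodule.eq_bot_iff]
  intro h
  have hone : (1 : ZMod 2) + 1 = 0 := by decide
  exact one_ne_zero (congrFun (h (fun _ ↦ (1 : ZMod 2)) fun _ ↦ hone) (0, 0))

theorem pathChains_le_allowed {K : Type v} [CommRing K] {V : Type u} (G : Digraph V) (n : ℕ) :
    pathChains K G n ≤ allowed K G n := by
  cases n with
  | zero => exact le_rfl
  | succ n => exact inf_le_left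

theorem pathChains_eq_bot (K : Type v) [CommRing K] {n : ℕ} (hn : 5 ≤ n) :
    pathChains K exampleDigraph n = ⊥ := by
  refine eq_bot_iff.2 ((pathChains_le_allowed _ n).trans (Submodule.span_le.2 ?_))
  rintro _ ⟨x, hx, rfl⟩
  exfalso
  have h : ∀ a b, exampleDigraph.Adj a b → ∀ c, exampleDigraph.Adj b c →
      ∀ d, exampleDigraph.Adj c d → ∀ e, exampleDigraph.Adj d e →
      ∀ f, ¬ exampleDigraph.Adj e f := by decide +kernel
  obtain ⟨n, rfl⟩ := Nat.exists_eq_add_of_le' hn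
  exact h _ _ (hx ⟨0, by omega⟩) _ (hx ⟨1, by omega⟩) _ (hx ⟨2, by omega⟩) _ (hx ⟨3, by omega⟩) _
    (hx ⟨4, by omega⟩)

theorem finrank_pathChains_zero (F : Type v) [Field F] :
    Module.finrank F (pathChains F exampleDigraph 0) =
      Nat.card {x : Fin 1 → ExampleVertex // IsPath exampleDigraph x} :=
  finrank_allowed F exampleDigraph exampleDigraph_irrefl 0

theorem finrank_pathChains_one (F : Type v) [Field F] :
    Module.finrank F (pathChains F exampleDigraph 1) =
      Nat.card {x : Fin 2 → ExampleVertex // IsPath exampleDigraph x} := by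
  have h : pathChains F exampleDigraph 1 = allowed F exampleDigraph 1 :=
    inf_eq_left.2 fun x _ ↦ (mem_allowed_iff _ _).2 fun y _ hy ↦ (hy fun i ↦ i.elim0).elim
  rw [h, finrank_allowed F exampleDigraph exampleDigraph_irrefl]

theorem pathEulerDefined_example (F : Type v) [Field F] : PathEulerDefined F exampleDigraph :=
  pathEulerDefined_of_chains _ F fun _ ↦ pathChains_eq_bot F

theorem pathEuler_example_ne :
    pathEuler ℚ exampleDigraph ≠ pathEuler (ZMod 2) exampleDigraph := by
  rw [pathEuler_eq_sum _ ℚ fun _ ↦ pathChains_eq_bot ℚ,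
    pathEuler_eq_sum _ (ZMod 2) fun _ ↦ pathChains_eq_bot (ZMod 2)]
  simp only [Finset.sum_range_succ, Finset.sum_range_zero, finrank_pathChains_zero,
    finrank_pathChains_one, finrank_pathChains_two, finrank_pathChains_three,
    finrank_pathChains_four_rat]
  have h := finrank_pathChains_four_two
  omega

end Example
end PathHomology
end

theorem mainTheorem4 :
    (∀ (V : Type) [Finite V] (G : Digraph V) (p : ℕ) [Fact p.Prime],
      PathHomology.PathEulerDefined ℚ G → PathHomology.PathEulerDefined (ZMod p) G →
      PathHomology.pathEuler ℚ G ≠ PathHomology.pathEuler (ZMod p) G →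
      -- no space, with coefficients in `ℤ` and `ℤ/p`
      (¬ ∃ X : TopCat.{u},
        (∀ n : ℕ, Nonempty (PathHomology.pathHomology ℤ G n ≃+
          PathHomology.singularHomology ℤ X n)) ∧
        (∀ n : ℕ, Nonempty (PathHomology.pathHomology (ZMod p) G n ≃+
          PathHomology.singularHomology (ZMod p) X n))) ∧
      -- no space with homology of finite type, with coefficients in `ℚ` and `ℤ/p`
      (¬ ∃ X : TopCat.{u},
        (∀ n : ℕ, Module.Finite ℤ (PathHomology.singularHomology ℤ X n)) ∧
        (∀ n : ℕ, Nonempty (PathHomology.pathHomology ℚ G n ≃ₗ[ℚ]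
          PathHomology.singularHomology ℚ X n)) ∧
        (∀ n : ℕ, Nonempty (PathHomology.pathHomology (ZMod p) G n ≃ₗ[ZMod p]
          PathHomology.singularHomology (ZMod p) X n))) ∧
      -- no free chain complex with homology of finite type
      (¬ ∃ C : ChainComplex (ModuleCat.{v} ℤ) ℤ,
        (∀ n : ℤ, Module.Free ℤ (C.X n)) ∧
        (∀ n : ℤ, Module.Finite ℤ (C.homology n)) ∧
        (∀ n : ℤ, Nonempty (PathHomology.pathHomology ℚ G n ≃ₗ[ℚ]
          (PathHomology.tensorComplex C ℚ).homology n)) ∧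
        (∀ n : ℤ, Nonempty (PathHomology.pathHomology (ZMod p) G n ≃ₗ[ZMod p]
          (PathHomology.tensorComplex C (ZMod p)).homology n))) ∧
      -- failure of the universal coefficient sequence
      (∃ n : ℤ, ¬ ∃ (f : TensorProduct ℤ (PathHomology.pathHomology ℤ G n) (ZMod p) →+
            PathHomology.pathHomology (ZMod p) G n)
          (g : PathHomology.pathHomology (ZMod p) G n →+
            PathHomology.tor (PathHomology.pathHomology ℤ G (n - 1)) (ModuleCat.of ℤ (ZMod p))),
        Function.Injective f ∧ Function.Exact f g ∧ Function.Surjective g)) ∧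
    -- the hypotheses hold for the digraph `𝒢` with `p = 2`
    (PathHomology.PathEulerDefined ℚ PathHomology.exampleDigraph ∧
      PathHomology.PathEulerDefined (ZMod 2) PathHomology.exampleDigraph ∧
      PathHomology.pathEuler ℚ PathHomology.exampleDigraph ≠
        PathHomology.pathEuler (ZMod 2) PathHomology.exampleDigraph) := by
  refine ⟨fun V _ G p _ hQ hp hne ↦ ⟨?_, ?_, ?_, ?_⟩,
    PathHomology.pathEulerDefined_example ℚ, PathHomology.pathEulerDefined_example (ZMod 2),
    PathHomology.pathEuler_example_ne⟩
  · rintro ⟨X, h1, h2⟩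
    exact hne (PathHomology.pathEuler_eq_of_space_int X G p hQ hp h1 h2)
  · rintro ⟨X, hX, h1, h2⟩
    exact hne (PathHomology.pathEuler_eq_of_space_rat X G p hQ hp hX h1 h2)
  · rintro ⟨C, hfree, hC, h1, h2⟩
    exact hne (PathHomology.pathEuler_eq_of_chainComplex C G p hQ hp hC h1 h2)
  · by_contra h
    push Not at h
    exact hne (PathHomology.pathEuler_eq_of_exact G p hQ hp h)
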